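/- For an irrational $x\in(0,1)$ with regular continued fraction expansion $x=[0;a_1,a_2,a_3,\dots]$ put $S_x(t)=a_1+a_2+\dots+a_t$ for $t\ge 1$. Let $?:[0,1]\to[0,1]$ be the Minkowski question mark function, that is, the continuous function with $?(0)=0$, $?(1)=1$ and $$?\left(\frac{p+p'}{q+q'}\right)=\frac12\left(?\left(\frac pq\right)+?\left(\frac{p'}{q'}\right)\right)$$ for all fractions $\frac pq<\frac{p'}{q'}$ that are consecutive elements of some Stern–Brocot sequence $F_n$, $n\ge 0$; here $F_0=\{\frac01,\frac11\}$, and $F_{n+1}$ arises from $F_n$ by inserting the mediant $\frac{a+c}{b+d}$ between any two consecutive elements $\frac ab,\frac cd$ of $F_n$. Write $?'(x)=+\infty$ if $\frac{?(y)-?(x)}{y-x}\to+\infty$ as $y\to x$, $y\ne x$. Put $\lambda_j=\frac{j+\sqrt{j^2+4}}{2}$ and $$\kappa_1=\frac{2\log\lambda_1}{\log 2}\approx 1.388,\qquad \kappa_2=\frac{4\log\lambda_5-5\log\lambda_4}{\log\lambda_5-\log\lambda_4-\log\sqrt2}\approx 4.401.$$ 1. If $x\in(0,1)$ is irrational and $\limsup_{t\to\infty}\frac{S_x(t)}{t}<\kappa_1$,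 then $?'(x)$ exists and $?'(x)=+\infty$. 2. There exists an irrational $x\in(0,1)$ such that $\lim_{t\to\infty}\frac{S_x(t)}{t}=\kappa_1$ and $?'(x)=0$. 3. If $x\in(0,1)$ is irrational and $\liminf_{t\to\infty}\frac{S_x(t)}{t}>\kappa_2$ (where the lower limit may be $+\infty$), then $?'(x)$ exists and $?'(x)=0$. 4. There exists an irrational $x\in(0,1)$ such that $\lim_{t\to\infty}\frac{S_x(t)}{t}=\kappa_2$ and $?'(x)=+\infty$. -/

import Mathlib

open Filter Topology

namespace MinkowskiQuestionMark

/-- The `j`-th fraction `x_{j,n} = p / q` of the Stern–Brocot sequence `F_n` of `[0, 1]`, for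
`0 ≤ j ≤ 2 ^ n`, in increasing order and given as the pair `(p, q)`. Here `F_0 = {0/1, 1/1}`, and
`F_{n+1}` arises from `F_n` by inserting the mediant between any two consecutive elements, so that
`x_{2k,n+1} = x_{k,n}` and `x_{2k+1,n+1}` is the mediant of `x_{k,n}` and `x_{k+1,n}`. -/
def sternBrocot : ℕ → ℕ → ℕ × ℕ
  | 0, j => if j = 0 then (0, 1) else (1, 1)
  | n + 1, j =>
    if j % 2 = 0 then sternBrocot n (j / 2)
    else ((sternBrocot n (j / 2)).1 + (sternBrocot n (j / 2 + 1)).1,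
      (sternBrocot n (j / 2)).2 + (sternBrocot n (j / 2 + 1)).2)

/-- The fraction `x_{j,n}` as a real number. -/
noncomputable def node (n j : ℕ) : ℝ :=
  ((sternBrocot n j).1 : ℝ) / ((sternBrocot n j).2 : ℝ)

/-- The value of the question mark function at `x_{j,n}`: it is `0` at `0/1`, `1` at `1/1`, and at
the mediant of two consecutive fractions it is the mean of the values at these two. -/
noncomputable def nodeValue : ℕ → ℕ → ℝ
  | 0, j => if j = 0 then 0 else 1
  | n + 1, j =>
    if j % 2 = 0 then nodeValue n (j / 2)
    else (nodeValue n (j / 2) + nodeValue n (j / 2 + 1)) / 2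

/-- The Minkowski question mark function on `[0, 1]`: the continuous increasing extension of
`nodeValue` from the rationals of `[0, 1]`, obtained as the supremum of the values at the
rationals that do not exceed `x`. -/
noncomputable def questionMark (x : ℝ) : ℝ :=
  sSup {v : ℝ | ∃ n j : ℕ, j ≤ 2 ^ n ∧ node n j ≤ x ∧ v = nodeValue n j}

/-- The partial quotient `a_{i+1}` of the regular continued fraction `x = [a_0; a_1, a_2, …]`
(the default value `0` is used only if the expansion stops, so never for irrational `x`). -/
noncomputable def partialQuotient (x : ℝ) (i : ℕ) : ℝ :=
  ((GenContFract.of x).partDens.get? i).getD 0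

/-- `S_x(t) = a_1 + ⋯ + a_t`. -/
noncomputable def S (x : ℝ) (t : ℕ) : ℝ :=
  ∑ i ∈ Finset.range t, partialQuotient x i

/-- `λ_j = (j + √(j² + 4)) / 2`. -/
noncomputable def lam (j : ℕ) : ℝ := ((j : ℝ) + √((j : ℝ) ^ 2 + 4)) / 2

/-- `κ₁ = 2 log λ₁ / log 2`, about `1.388`. -/
noncomputable def kappa1 : ℝ := 2 * Real.log (lam 1) / Real.log 2

/-- `κ₂ = (4 log λ₅ - 5 log λ₄) / (log λ₅ - log λ₄ - log √2)`, about `4.401`. -/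
noncomputable def kappa2 : ℝ :=
  (4 * Real.log (lam 5) - 5 * Real.log (lam 4)) /
    (Real.log (lam 5) - Real.log (lam 4) - Real.log √2)

/-- `f'(x)` exists as an improper derivative and equals `+∞`: the difference quotient
`(f y - f x) / (y - x)` tends to `+∞` as `y → x`, `y ≠ x`. -/
def HasDerivAtTop (f : ℝ → ℝ) (x : ℝ) : Prop :=
  Tendsto (fun y => (f y - f x) / (y - x)) (𝓝[≠] x) atTop

end MinkowskiQuestionMark

namespace MinkowskiQuestionMark

/-! A cell of level n between consecutive fractions with denominators p and q has length 1/(pq),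
while ? grows by 2^(-n) across it. Hence ?'(x) is governed by the denominators of the cells around
x: it is +∞ if pq/2^n → ∞, and 0 if (p+q)²/2^n → 0 (`hasDerivAtTop_questionMark`,
`hasDerivAt_questionMark_zero`). The cell of level S_x(t)+k-1, 1 ≤ k ≤ a_{t+1}, has denominators q_t
and k q_t + q_{t-1} (`IsExpansion.exists_inCell`), so it suffices that q_t²/2^{S_x(t+1)} → ∞,
respectively q_t²/2^{S_x(t)} → 0.

It remains to compare 2 log q_t with S_x(t) log 2. From below, q_t ≥ λ_1^(t-1), which produces κ₁
(`lam_one_pow_le`). From above, q_t ≤ ∏ λ_{a_i} by operator norms (`contDen_le_exp`); since log λ_j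
= arsinh(j/2) is concave in j, its values at integers lie on or below the chord through j = 4 and j
= 5 (`log_lam_le`), and κ₂ is the abscissa where this chord meets the line s ↦ s log √2.

Both thresholds are attained by perturbing on blocks [k^4, (k+1)^4). With r the fourth root of t, a
shift of S_x(t) by order r³ does not change the limit of S_x(t)/t, but it beats errors O(r²) in log
q_t. For κ₁ all quotients are 1 except a large one at the end of each block. For κ₂ each block
consists of fours followed by fives; only the descents from 5 to 4, at most one per block, lose
anything against ∏ λ_{a_i}. -/

/-! ### Stern–Brocot cells and the values of ? at their endpoints. -/

theorem sternBrocot_even (n j : ℕ) : sternBrocot (n + 1) (2 * j) = sternBrocot n j := by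
  simp [sternBrocot]

theorem sternBrocot_odd (n j : ℕ) :
    sternBrocot (n + 1) (2 * j + 1) = sternBrocot n j + sternBrocot n (j + 1) := by
  have h1 : (2 * j + 1) % 2 = 1 := by omega
  have h2 : (2 * j + 1) / 2 = j := by omega
  simp only [sternBrocot, h1, h2]
  simp [Prod.ext_iff]

theorem sternBrocot_den_pos (n j : ℕ) : 0 < (sternBrocot n j).2 := by
  induction n generalizing j with
  | zero => simp only [sternBrocot]; split_ifs <;> simp
  | succ n ih =>
    obtain ⟨i, rfl | rfl⟩ := Nat.even_or_odd' j
    · rw [sternBrocot_even]; exact ih i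
    · rw [sternBrocot_odd]; have := ih i; simp only [Prod.snd_add]; omega

theorem sternBrocot_unimodular (n j : ℕ) (hj : j < 2 ^ n) :
    (sternBrocot n (j + 1)).1 * (sternBrocot n j).2 =
      (sternBrocot n j).1 * (sternBrocot n (j + 1)).2 + 1 := by
  induction n generalizing j with
  | zero =>
    obtain rfl : j = 0 := by simpa using hj
    simp [sternBrocot]
  | succ n ih =>
    obtain ⟨i, rfl | rfl⟩ := Nat.even_or_odd' j
    · have := ih i (by rw [pow_succ] at hj; omega)
      rw [sternBrocot_even, sternBrocot_odd]
      simp only [Prod.fst_add, Prod.snd_add]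
      linarith
    · have := ih i (by rw [pow_succ] at hj; omega)
      rw [show 2 * i + 1 + 1 = 2 * (i + 1) by ring, sternBrocot_even, sternBrocot_odd]
      simp only [Prod.fst_add, Prod.snd_add]
      linarith

/-- The denominator of the `j`-th fraction of `F_n`, as a real number. -/
noncomputable def den (n j : ℕ) : ℝ := ((sternBrocot n j).2 : ℝ)

theorem den_pos (n j : ℕ) : 0 < den n j := by
  simpa [den] using sternBrocot_den_pos n j

theorem one_le_den (n j : ℕ) : 1 ≤ den n j := by
  have := sternBrocot_den_pos n j
  simp only [den]
  exact_mod_cast this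

theorem den_odd (n j : ℕ) : den (n + 1) (2 * j + 1) = den n j + den n (j + 1) := by
  simp [den, sternBrocot_odd]

theorem den_even (n j : ℕ) : den (n + 1) (2 * j) = den n j := by
  simp [den, sternBrocot_even]

theorem node_even (n j : ℕ) : node (n + 1) (2 * j) = node n j := by
  simp [node, sternBrocot_even]

theorem node_succ_sub (n j : ℕ) (hj : j < 2 ^ n) :
    node n (j + 1) - node n j = 1 / (den n j * den n (j + 1)) := by
  have h1 := den_pos n j
  have h2 := den_pos n (j + 1)
  have h := sternBrocot_unimodular n j hj
  have h' : ((sternBrocot n (j + 1)).1 : ℝ) * den n j =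
      (sternBrocot n j).1 * den n (j + 1) + 1 := by
    simp only [den]; exact_mod_cast h
  change _ / den n (j + 1) - _ / den n j = _
  field_simp
  linarith

theorem node_lt_succ (n j : ℕ) (hj : j < 2 ^ n) : node n j < node n (j + 1) := by
  have := node_succ_sub n j hj
  have h1 := den_pos n j
  have h2 := den_pos n (j + 1)
  have : 0 < 1 / (den n j * den n (j + 1)) := by positivity
  linarith

theorem node_lt_node {n i j : ℕ} (hij : i < j) (hj : j ≤ 2 ^ n) : node n i < node n j := by
  induction j with
  | zero => omega
  | succ j ih =>
    have h := node_lt_succ n j (by omega)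
    rcases Nat.lt_succ_iff_lt_or_eq.1 hij with h' | rfl
    · exact (ih h' (by omega)).trans h
    · exact h

theorem node_le_node {n i j : ℕ} (hij : i ≤ j) (hj : j ≤ 2 ^ n) : node n i ≤ node n j := by
  rcases hij.eq_or_lt with rfl | h
  · exact le_rfl
  · exact (node_lt_node h hj).le

theorem node_nonneg (n j : ℕ) : 0 ≤ node n j := by unfold node; positivity

theorem node_add (n m j : ℕ) : node (n + m) (2 ^ m * j) = node n j := by
  induction m with
  | zero => simp
  | succ m ih => rw [← add_assoc, pow_succ', mul_assoc, node_even, ih]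

theorem nodeValue_eq (n j : ℕ) (hj : j ≤ 2 ^ n) : nodeValue n j = j / 2 ^ n := by
  induction n generalizing j with
  | zero =>
    have : j = 0 ∨ j = 1 := by simp at hj; omega
    rcases this with rfl | rfl <;> simp [nodeValue]
  | succ n ih =>
    rw [pow_succ] at hj
    obtain ⟨i, rfl | rfl⟩ := Nat.even_or_odd' j
    · have := ih i (by omega)
      simp only [nodeValue, Nat.mul_mod_right, if_true]
      rw [show 2 * i / 2 = i by omega, this, pow_succ]
      push_cast; field_simp
    · have h0 := ih i (by omega)
      have h1 := ih (i + 1) (by omega)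
      simp only [nodeValue, show (2 * i + 1) % 2 = 1 by omega]
      rw [show (2 * i + 1) / 2 = i by omega, h0, h1, pow_succ]
      push_cast; field_simp
      ring

/-- Both fractions reappear at the common level n + n', where the order of fractions is the order of
indices. -/
theorem nodeValue_le_of_node_le {n j n' j' : ℕ} (hj : j ≤ 2 ^ n) (hj' : j' ≤ 2 ^ n')
    (h : node n' j' ≤ node n j) : nodeValue n' j' ≤ nodeValue n j := by
  rw [nodeValue_eq n j hj, nodeValue_eq n' j' hj']
  rw [← node_add n n' j, ← node_add n' n j', add_comm n' n] at h
  have h2 : 2 ^ n * j' ≤ 2 ^ n' * j := by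
    by_contra! hlt
    refine absurd h (not_le.2 (node_lt_node hlt ?_))
    rw [pow_add]; gcongr
  rw [div_le_div_iff₀ (by positivity) (by positivity)]
  have : (2 : ℝ) ^ n * j' ≤ 2 ^ n' * j := by exact_mod_cast h2
  linarith

theorem questionMark_bddAbove (x : ℝ) :
    BddAbove {v : ℝ | ∃ n j : ℕ, j ≤ 2 ^ n ∧ node n j ≤ x ∧ v = nodeValue n j} := by
  refine ⟨1, ?_⟩
  rintro v ⟨n, j, hj, -, rfl⟩
  rw [nodeValue_eq n j hj, div_le_one (by positivity)]
  exact_mod_cast hj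

theorem questionMark_node {n j : ℕ} (hj : j ≤ 2 ^ n) : questionMark (node n j) = j / 2 ^ n := by
  rw [← nodeValue_eq n j hj]
  refine IsGreatest.csSup_eq ⟨⟨n, j, hj, le_rfl, rfl⟩, ?_⟩
  rintro v ⟨n', j', hj', h, rfl⟩
  exact nodeValue_le_of_node_le hj hj' h

theorem questionMark_mono {x y : ℝ} (hx : 0 ≤ x) (hxy : x ≤ y) :
    questionMark x ≤ questionMark y := by
  refine csSup_le_csSup (questionMark_bddAbove y) ?_ ?_
  · exact ⟨_, 0, 0, by simp, by simpa [node, sternBrocot] using hx, rfl⟩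
  · rintro v ⟨n, j, hj, h, rfl⟩
    exact ⟨n, j, hj, h.trans hxy, rfl⟩

/-! ### Cells around a point and the neighbours of a mediant. -/

/-- `x` lies strictly between the `j`-th and the `(j+1)`-st element of `F_n`. -/
def InCell (n j : ℕ) (x : ℝ) : Prop := j < 2 ^ n ∧ node n j < x ∧ x < node n (j + 1)

theorem InCell.unique {n i j : ℕ} {x : ℝ} (hi : InCell n i x) (hj : InCell n j x) : i = j := by
  by_contra hne
  rcases Nat.lt_or_gt_of_ne hne with h | h
  · have := node_le_node (n := n) (i := i + 1) (j := j) (by omega) hj.1.le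
    linarith [hi.2.2, hj.2.1]
  · have := node_le_node (n := n) (i := j + 1) (j := i) (by omega) hi.1.le
    linarith [hj.2.2, hi.2.1]

theorem le_den_add_den (n j : ℕ) : (n : ℝ) + 2 ≤ den n j + den n (j + 1) := by
  induction n generalizing j with
  | zero => have := one_le_den 0 j; have := one_le_den 0 (j + 1); norm_num; linarith
  | succ n ih =>
    obtain ⟨i, rfl | rfl⟩ := Nat.even_or_odd' j
    · have := ih i; have := one_le_den n i
      rw [den_even, den_odd]; push_cast; linarith
    · have := ih i; have := one_le_den n (i + 1)
      rw [show 2 * i + 1 + 1 = 2 * (i + 1) by ring, den_even, den_odd]; push_cast; linarith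

theorem node_succ_sub_le (n j : ℕ) (hj : j < 2 ^ n) :
    node n (j + 1) - node n j ≤ 1 / (n + 1) := by
  rw [node_succ_sub n j hj]
  have h1 := one_le_den n j
  have h2 := one_le_den n (j + 1)
  have h3 := le_den_add_den n j
  gcongr
  nlinarith

/-- The index, `u` levels further down, of the left neighbour of the mediant of two consecutive
fractions of indices `j` and `j + 1`. -/
def leftIndex (j : ℕ) : ℕ → ℕ
  | 0 => 2 * j
  | u + 1 => 2 * leftIndex j u + 1

theorem leftIndex_le {n j : ℕ} (hj : j < 2 ^ n) (u : ℕ) :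
    leftIndex j u + 2 ≤ 2 ^ (n + 1 + u) := by
  induction u with
  | zero => rw [leftIndex, pow_add, pow_add]; omega
  | succ u ih => rw [leftIndex, ← add_assoc, pow_succ]; omega

theorem node_leftIndex_succ (n j u : ℕ) :
    node (n + 1 + u) (leftIndex j u + 1) = node (n + 1) (2 * j + 1) := by
  induction u with
  | zero => rfl
  | succ u ih => rw [← ih]; exact node_even (n + 1 + u) (leftIndex j u + 1)

theorem den_leftIndex_succ (n j u : ℕ) :
    den (n + 1 + u) (leftIndex j u + 1) = den n j + den n (j + 1) := by
  induction u with
  | zero => exact den_odd n j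
  | succ u ih => rw [← ih]; exact den_even (n + 1 + u) (leftIndex j u + 1)

theorem den_leftIndex (n j u : ℕ) :
    den (n + 1 + u) (leftIndex j u) = den n j + u * (den n j + den n (j + 1)) := by
  induction u with
  | zero => simp [leftIndex, den_even]
  | succ u ih =>
    rw [leftIndex, ← add_assoc, den_odd, ih, den_leftIndex_succ]; push_cast; ring

theorem den_leftIndex_add_two (n j u : ℕ) :
    den (n + 1 + u) (leftIndex j u + 2) = den n (j + 1) + u * (den n j + den n (j + 1)) := by
  induction u with
  | zero => simp only [Nat.cast_zero, zero_mul, add_zero]; exact den_even n (j + 1)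
  | succ u ih =>
    rw [leftIndex, ← add_assoc, show 2 * leftIndex j u + 1 + 2 = 2 * (leftIndex j u + 1) + 1 by ring,
      den_odd, ih, den_leftIndex_succ]
    push_cast; ring

theorem exists_last {P : ℕ → Prop} {N : ℕ} (h0 : P N) (h : ¬ ∀ n ≥ N, P n) :
    ∃ n ≥ N, P n ∧ ¬ P (n + 1) := by
  by_contra! hc
  exact h fun n hn => Nat.le_induction h0 (fun m hm ih => hc m hm ih) n hn

theorem questionMark_sub {n i j : ℕ} (hi : i ≤ 2 ^ n) (hj : j ≤ 2 ^ n) :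
    questionMark (node n j) - questionMark (node n i) = ((j : ℝ) - i) / 2 ^ n := by
  rw [questionMark_node hi, questionMark_node hj, sub_div]

theorem mediant_sub_node_leftIndex {n j : ℕ} (hj : j < 2 ^ n) (u : ℕ) :
    node (n + 1) (2 * j + 1) - node (n + 1 + u) (leftIndex j u) =
      1 / ((den n j + u * (den n j + den n (j + 1))) * (den n j + den n (j + 1))) := by
  have := leftIndex_le hj u
  rw [← node_leftIndex_succ n j u, node_succ_sub _ _ (by omega), den_leftIndex,
    den_leftIndex_succ]

theorem node_leftIndex_sub_mediant {n j : ℕ} (hj : j < 2 ^ n) (u : ℕ) :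
    node (n + 1 + u) (leftIndex j u + 2) - node (n + 1) (2 * j + 1) =
      1 / ((den n j + den n (j + 1)) * (den n (j + 1) + u * (den n j + den n (j + 1)))) := by
  have := leftIndex_le hj u
  rw [← node_leftIndex_succ n j u, node_succ_sub _ (leftIndex j u + 1) (by omega),
    den_leftIndex_succ, den_leftIndex_add_two]

/-- Two points on both sides of a mediant: the increments of `?` and of the argument are controlled
by the last neighbours of the mediant that enclose both points. -/
theorem exists_enclosing_neighbours {n j : ℕ} {a b : ℝ} (hj : j < 2 ^ n) (hab : a < b)
    (ha : node n j ≤ a) (ham : a ≤ node (n + 1) (2 * j + 1)) (hmb : node (n + 1) (2 * j + 1) ≤ b)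
    (hb : b ≤ node n (j + 1)) :
    ∃ u : ℕ, node (n + 1 + u) (leftIndex j u) ≤ a ∧ b ≤ node (n + 1 + u) (leftIndex j u + 2) ∧
      1 / 2 ^ (n + 2 + u) ≤ questionMark b - questionMark a ∧
      questionMark b - questionMark a ≤ 1 / 2 ^ (n + u) ∧
      b - a ≤ 1 / ((den n j + u * (den n j + den n (j + 1))) * (den n j + den n (j + 1))) +
        1 / ((den n j + den n (j + 1)) * (den n (j + 1) + u * (den n j + den n (j + 1)))) ∧
      1 / ((u + 2) * (den n j + den n (j + 1)) ^ 2) ≤ b - a := by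
  have hd0 := one_le_den n j
  have hd1 := one_le_den n (j + 1)
  have ha0 : 0 ≤ a := (node_nonneg _ _).trans ha
  -- Take the largest u for which the neighbours of the mediant still enclose both points; it exists
  -- because the enclosing intervals shrink to the mediant.
  obtain ⟨u, -, ⟨h1, h2⟩, h3⟩ := exists_last (N := 0)
    (P := fun u => node (n + 1 + u) (leftIndex j u) ≤ a ∧
      b ≤ node (n + 1 + u) (leftIndex j u + 2))
    ⟨by simpa [leftIndex, node_even] using ha, by
      exact hb.trans_eq (node_even n (j + 1)).symm⟩ (by
      intro h
      obtain ⟨k, hk⟩ := exists_nat_gt (2 / (b - a))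
      obtain ⟨h1, h2⟩ := h k (Nat.zero_le _)
      have hl := leftIndex_le hj k
      have e1 := node_succ_sub_le (n + 1 + k) (leftIndex j k) (by omega)
      have e2 := node_succ_sub_le (n + 1 + k) (leftIndex j k + 1) (by omega)
      have e3 : b - a ≤ 2 / (((n + 1 + k : ℕ) : ℝ) + 1) := by
        have : 2 / (((n + 1 + k : ℕ) : ℝ) + 1) = 1 / (((n + 1 + k : ℕ) : ℝ) + 1) +
          1 / (((n + 1 + k : ℕ) : ℝ) + 1) := by ring
        linarith
      rw [le_div_iff₀ (by positivity)] at e3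
      rw [div_lt_iff₀ (by linarith)] at hk
      push_cast at e3
      nlinarith [(Nat.cast_nonneg n : (0 : ℝ) ≤ n)])
  have hl := leftIndex_le hj u
  have hl' := leftIndex_le hj (u + 1)
  refine ⟨u, h1, h2, ?_, ?_, ?_, ?_⟩
  -- As enclosure fails at u + 1, one of the two cells next to the mediant at that level lies inside
  -- [a, b]. This gives the lower bounds both for the increment of ? and for b - a.
  · have key : ∀ c, c + 1 ≤ 2 ^ (n + 1 + (u + 1)) → a ≤ node (n + 1 + (u + 1)) c →
        node (n + 1 + (u + 1)) (c + 1) ≤ b →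
        1 / 2 ^ (n + 2 + u) ≤ questionMark b - questionMark a := by
      intro c hc hac hcb
      have e1 := questionMark_mono ha0 hac
      have e2 := questionMark_mono (node_nonneg _ _) hcb
      have e3 := questionMark_sub (show c ≤ 2 ^ (n + 1 + (u + 1)) by omega) hc
      have e4 : ((c + 1 : ℕ) - (c : ℝ)) / 2 ^ (n + 1 + (u + 1)) = 1 / 2 ^ (n + 2 + u) := by
        rw [show n + 2 + u = n + 1 + (u + 1) by ring]; push_cast; ring
      linarith
    have em := node_leftIndex_succ n j (u + 1)
    by_cases hc : node (n + 1 + (u + 1)) (leftIndex j (u + 1)) ≤ a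
    · have hb' : ¬ b ≤ node (n + 1 + (u + 1)) (leftIndex j (u + 1) + 2) := fun h => h3 ⟨hc, h⟩
      exact key _ (by omega) (ham.trans_eq em.symm) (not_le.1 hb').le
    · exact key _ (by omega) (not_le.1 hc).le (em.trans_le hmb)
  · have e1 := questionMark_mono (node_nonneg _ _) h1
    have e2 := questionMark_mono (ha0.trans hab.le) h2
    have e3 := questionMark_sub (show leftIndex j u ≤ 2 ^ (n + 1 + u) by omega) hl
    have e4 : ((leftIndex j u + 2 : ℕ) - (leftIndex j u : ℝ)) / 2 ^ (n + 1 + u) =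
        1 / 2 ^ (n + u) := by
      rw [show n + 1 + u = n + u + 1 by ring, pow_succ]; push_cast; field_simp; ring
    linarith
  · have := mediant_sub_node_leftIndex hj u
    have := node_leftIndex_sub_mediant hj u
    linarith
  · have e1 := mediant_sub_node_leftIndex hj (u + 1)
    have e2 := node_leftIndex_sub_mediant hj (u + 1)
    push_cast at e1 e2
    have hu : (0 : ℝ) ≤ u := by positivity
    by_cases hc : node (n + 1 + (u + 1)) (leftIndex j (u + 1)) ≤ a
    · have hb' : ¬ b ≤ node (n + 1 + (u + 1)) (leftIndex j (u + 1) + 2) := fun h => h3 ⟨hc, h⟩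
      have : 1 / ((u + 2) * (den n j + den n (j + 1)) ^ 2) ≤ 1 / ((den n j + den n (j + 1)) *
          (den n (j + 1) + (u + 1) * (den n j + den n (j + 1)))) := by
        refine one_div_le_one_div_of_le (by positivity) ?_
        nlinarith [mul_nonneg hu (mul_nonneg (den_pos n j).le (den_pos n j).le)]
      linarith [not_le.1 hb']
    · have : 1 / ((u + 2) * (den n j + den n (j + 1)) ^ 2) ≤ 1 / ((den n j + (u + 1) *
          (den n j + den n (j + 1))) * (den n j + den n (j + 1))) := by
        refine one_div_le_one_div_of_le (by positivity) ?_
        nlinarith [mul_nonneg hu (mul_nonneg (den_pos n j).le (den_pos n j).le)]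
      linarith [not_le.1 hc]

/-- Near an irrational `x`, any other point is separated from `x` by the mediant of a fine cell. -/
theorem exists_separating_cell {x y : ℝ} {N : ℕ} (hx : Irrational x)
    (hy : ∃ j, InCell N j x ∧ InCell N j y) (hne : y ≠ x) :
    ∃ n ≥ N, ∃ j, InCell n j x ∧ node n j ≤ y ∧ y ≤ node n (j + 1) ∧
      ((x < node (n + 1) (2 * j + 1) ∧ node (n + 1) (2 * j + 1) ≤ y) ∨
        (y ≤ node (n + 1) (2 * j + 1) ∧ node (n + 1) (2 * j + 1) < x)) := by
  -- The last level at which x and y share a closed cell: the mediant of that cell must then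
  -- separate them.
  obtain ⟨n, hn, ⟨j, hj, hy1, hy2⟩, h⟩ := exists_last (N := N)
    (P := fun n => ∃ j, InCell n j x ∧ node n j ≤ y ∧ y ≤ node n (j + 1))
    (by obtain ⟨j, h1, h2⟩ := hy; exact ⟨j, h1, h2.2.1.le, h2.2.2.le⟩) (by
      intro h
      obtain ⟨k, hk⟩ := exists_nat_gt (1 / |y - x|)
      have hpos : 0 < |y - x| := abs_pos.2 (sub_ne_zero.2 hne)
      obtain ⟨j, h1, h2, h3⟩ := h (N + k) (by omega)
      have e := node_succ_sub_le (N + k) j h1.1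
      have e' : |y - x| ≤ 1 / (((N + k : ℕ) : ℝ) + 1) := by
        rw [abs_le]; constructor <;> linarith [h1.2.1, h1.2.2]
      rw [le_div_iff₀ (by positivity)] at e'
      rw [div_lt_iff₀ hpos] at hk
      push_cast at e'
      nlinarith [(Nat.cast_nonneg N : (0 : ℝ) ≤ N)])
  refine ⟨n, hn, j, hj, hy1, hy2, ?_⟩
  have hj0 := hj.1
  have h2 : node (n + 1) (2 * j + 2) = node n (j + 1) := node_even n (j + 1)
  rcases lt_trichotomy x (node (n + 1) (2 * j + 1)) with hlt | heq | hgt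
  · left
    refine ⟨hlt, ?_⟩
    by_contra! hc
    exact h ⟨2 * j, ⟨by rw [pow_succ]; omega, by rw [node_even]; exact hj.2.1, hlt⟩,
      by rwa [node_even], hc.le⟩
  · exfalso
    refine hx ⟨((sternBrocot (n + 1) (2 * j + 1)).1 : ℚ) / (sternBrocot (n + 1) (2 * j + 1)).2, ?_⟩
    rw [heq]; simp [node]
  · right
    refine ⟨?_, hgt⟩
    by_contra! hc
    exact h ⟨2 * j + 1, ⟨by rw [pow_succ]; omega, hgt, by rw [h2]; exact hj.2.2⟩,
      hc.le, by rwa [h2]⟩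

/-! ### Criteria for ?' in terms of the cells around x. -/

theorem eventually_inCell {n j : ℕ} {x : ℝ} (h : InCell n j x) : ∀ᶠ y in 𝓝[≠] x, InCell n j y :=
  nhdsWithin_le_nhds (mem_of_superset (Ioo_mem_nhds h.2.1 h.2.2) fun _ hy => ⟨h.1, hy.1, hy.2⟩)

theorem div_sub_comm_pair (f : ℝ → ℝ) (x y : ℝ) :
    (f y - f x) / (y - x) = (f x - f y) / (x - y) := by
  rw [← neg_sub (f x), ← neg_sub x, neg_div_neg_eq]

/-- The increment of ? is at most 2^(-n-u) and that of the argument at least 1/((u+2)(p+q)²). The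
linear factor u + 2 is absorbed by 2^u, so only the separating cell itself matters. -/
theorem hasDerivAt_questionMark_zero {x : ℝ} (hx : Irrational x)
    (hcell : ∀ n, ∃ j, InCell n j x)
    (h : ∀ ε > 0, ∃ N, ∀ n ≥ N, ∀ j, InCell n j x →
      (den n j + den n (j + 1)) ^ 2 ≤ ε * 2 ^ n) :
    HasDerivAt questionMark 0 x := by
  rw [hasDerivAt_iff_tendsto_slope, Metric.tendsto_nhds]
  intro ε hε
  obtain ⟨N, hN⟩ := h (ε / 4) (by positivity)
  obtain ⟨j, hj⟩ := hcell N
  filter_upwards [eventually_inCell hj, self_mem_nhdsWithin] with y hy hne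
  obtain ⟨n, hn, i, hi, hy1, hy2, hsep⟩ := exists_separating_cell hx ⟨j, hj, hy⟩ hne
  have hT := hN n hn i hi
  have key : ∀ a b : ℝ, a < b → node n i ≤ a → a ≤ node (n + 1) (2 * i + 1) →
      node (n + 1) (2 * i + 1) ≤ b → b ≤ node n (i + 1) →
      |(questionMark b - questionMark a) / (b - a)| < ε := by
    intro a b hab h1 h2 h3 h4
    obtain ⟨u, -, -, hQ0, hQ, -, hw⟩ := exists_enclosing_neighbours hi.1 hab h1 h2 h3 h4
    have hd0 := den_pos n i
    have hd1 := den_pos n (i + 1)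
    have hQ0' : 0 ≤ questionMark b - questionMark a := le_trans (by positivity) hQ0
    rw [abs_of_nonneg (div_nonneg hQ0' (by linarith)), div_lt_iff₀ (by linarith)]
    have hu : ((u : ℝ) + 2) ≤ 2 * 2 ^ u := by
      have : u + 1 ≤ 2 ^ u := Nat.lt_two_pow_self
      have : (u : ℝ) + 1 ≤ 2 ^ u := by exact_mod_cast this
      have : (1 : ℝ) ≤ 2 ^ u := one_le_pow₀ (by norm_num)
      linarith
    have h5 : ε * (1 / ((u + 2) * (den n i + den n (i + 1)) ^ 2)) ≤ ε * (b - a) := by gcongr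
    have h6 : (1 : ℝ) / 2 ^ (n + u) < ε * (1 / ((u + 2) * (den n i + den n (i + 1)) ^ 2)) := by
      rw [mul_one_div, div_lt_div_iff₀ (by positivity) (by positivity), pow_add]
      calc 1 * (((u : ℝ) + 2) * (den n i + den n (i + 1)) ^ 2)
          ≤ (2 * 2 ^ u) * (ε / 4 * 2 ^ n) := by rw [one_mul]; gcongr
        _ < ε * (2 ^ n * 2 ^ u) := by
          have : 0 < ε * (2 ^ n * 2 ^ u) := by positivity
          linarith
    linarith
  rw [Real.dist_eq, sub_zero, slope_def_field]
  rcases hsep with ⟨h1, h2⟩ | ⟨h1, h2⟩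
  · exact key x y (by linarith) hi.2.1.le h1.le h2 hy2
  · rw [div_sub_comm_pair]
    exact key y x (by linarith) hy1 h1 h2.le hi.2.2.le

/-- Here the interval around the mediant may be much shorter than the separating cell. The
hypothesis is therefore used for the deeper cell next to the mediant that contains x. -/
theorem hasDerivAtTop_questionMark {x : ℝ} (hx : Irrational x)
    (hcell : ∀ n, ∃ j, InCell n j x)
    (h : ∀ C : ℝ, ∃ N, ∀ n ≥ N, ∀ j, InCell n j x → C * 2 ^ n ≤ den n j * den n (j + 1)) :
    HasDerivAtTop questionMark x := by
  rw [HasDerivAtTop, tendsto_atTop]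
  intro C
  -- The 6 is 3 · 2: the two cells at the mediant have total length at most 3 times that of the one
  -- containing x, and ? is only known to gain half of that cell's increment.
  obtain ⟨N, hN⟩ := h (6 * max C 0)
  obtain ⟨j, hj⟩ := hcell N
  filter_upwards [eventually_inCell hj, self_mem_nhdsWithin] with y hy hne
  obtain ⟨n, hn, i, hi, hy1, hy2, hsep⟩ := exists_separating_cell hx ⟨j, hj, hy⟩ hne
  have hR := hN n hn i hi
  refine (le_max_left C 0).trans ?_
  have hC : 0 ≤ max C 0 := le_max_right _ _
  generalize max C 0 = C at hC hN hR
  have key : ∀ a b : ℝ, a < b → node n i ≤ a → a ≤ node (n + 1) (2 * i + 1) →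
      node (n + 1) (2 * i + 1) ≤ b → b ≤ node n (i + 1) →
      ((x = a ∧ a < node (n + 1) (2 * i + 1)) ∨ (x = b ∧ node (n + 1) (2 * i + 1) < b)) →
      C ≤ (questionMark b - questionMark a) / (b - a) := by
    intro a b hab h1 h2 h3 h4 hxab
    obtain ⟨u, hua, hub, hQ, -, hw, -⟩ := exists_enclosing_neighbours hi.1 hab h1 h2 h3 h4
    have hd0 := one_le_den n i
    have hd1 := one_le_den n (i + 1)
    have hl := leftIndex_le hi.1 u
    rw [le_div_iff₀ (by linarith)]
    refine le_trans ?_ hQ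
    set p := den n i with hp
    set q := den n (i + 1) with hq
    have hw' : C * (b - a) ≤ C * (1 / ((p + u * (p + q)) * (p + q)) +
      1 / ((p + q) * (q + u * (p + q)))) := by gcongr
    refine hw'.trans ?_
    -- For u = 0 the lengths add up to 1/(pq), the length of the separating cell. For u ≥ 1 the two
    -- lengths differ by a factor at most 2, which fails for u = 0.
    rcases Nat.eq_zero_or_pos u with rfl | hu
    · have e : 1 / ((p + (0 : ℕ) * (p + q)) * (p + q)) + 1 / ((p + q) * (q + (0 : ℕ) * (p + q)))
        = 1 / (p * q) := by
        have : p ≠ 0 := by linarith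
        have : q ≠ 0 := by linarith
        have : p + q ≠ 0 := by linarith
        simp; field_simp; ring
      rw [e, mul_one_div, div_le_div_iff₀ (by positivity) (by positivity), add_zero, pow_add]
      have : 0 ≤ C * 2 ^ n := by positivity
      linarith
    · have hu' : (1 : ℝ) ≤ u := by exact_mod_cast hu
      have gen : ∀ s t : ℝ, 1 ≤ s → 1 ≤ t →
          6 * C * 2 ^ (n + 1 + u) ≤ (s + t) * (s + u * (s + t)) →
          C * (1 / ((s + t) * (s + u * (s + t))) + 1 / ((s + t) * (t + u * (s + t)))) ≤
            1 / 2 ^ (n + 2 + u) := by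
        intro s t hs ht hst
        have e1 : 1 / ((s + t) * (t + u * (s + t))) ≤ 2 * (1 / ((s + t) * (s + u * (s + t)))) := by
          rw [mul_one_div, div_le_div_iff₀ (by positivity) (by positivity)]
          have : s + u * (s + t) ≤ 2 * (t + u * (s + t)) := by nlinarith
          have := mul_le_mul_of_nonneg_left this (show 0 ≤ s + t by linarith)
          linarith
        have e2 : C * (1 / ((s + t) * (s + u * (s + t))) + 1 / ((s + t) * (t + u * (s + t)))) ≤
            C * (3 * (1 / ((s + t) * (s + u * (s + t))))) := by gcongr; linarith
        refine e2.trans ?_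
        rw [mul_one_div, mul_div_assoc', div_le_div_iff₀ (by positivity) (by positivity)]
        have : (2 : ℝ) ^ (n + 2 + u) = 2 * 2 ^ (n + 1 + u) := by ring
        rw [this]
        linarith
      rcases hxab with ⟨hxa, hlt⟩ | ⟨hxb, hlt⟩
      · have hc : InCell (n + 1 + u) (leftIndex i u) x := by
          refine ⟨by omega, lt_of_le_of_ne (hxa ▸ hua) ?_, by rw [node_leftIndex_succ, hxa]; exact hlt⟩
          intro heq
          refine hx ⟨((sternBrocot (n + 1 + u) (leftIndex i u)).1 : ℚ) /
            (sternBrocot (n + 1 + u) (leftIndex i u)).2, ?_⟩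
          rw [← heq]; simp [node]
        have := hN _ (by omega) _ hc
        rw [den_leftIndex, den_leftIndex_succ, ← hp, ← hq] at this
        have := gen p q hd0 hd1 (by linarith)
        rw [mul_comm (p + u * (p + q))]
        exact this
      · have hc : InCell (n + 1 + u) (leftIndex i u + 1) x := by
          refine ⟨by omega, by rw [node_leftIndex_succ, hxb]; exact hlt,
            lt_of_le_of_ne (hxb ▸ hub) ?_⟩
          intro heq
          refine hx ⟨((sternBrocot (n + 1 + u) (leftIndex i u + 2)).1 : ℚ) /
            (sternBrocot (n + 1 + u) (leftIndex i u + 2)).2, ?_⟩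
          rw [heq]; simp [node]
        have := hN _ (by omega) _ hc
        rw [den_leftIndex_succ, show leftIndex i u + 1 + 1 = leftIndex i u + 2 by rfl,
          den_leftIndex_add_two, ← hp, ← hq] at this
        have := gen q p hd1 hd0 (by linarith)
        rw [add_comm q p] at this
        rw [mul_comm (p + u * (p + q)), add_comm (1 / ((p + q) * (p + u * (p + q))))]
        exact this
  rcases hsep with ⟨h1, h2⟩ | ⟨h1, h2⟩
  · exact key x y (by linarith) hi.2.1.le h1.le h2 hy2 (Or.inl ⟨rfl, h1⟩)
  · rw [div_sub_comm_pair]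
    exact key y x (by linarith) hy1 h1 h2.le hi.2.2.le (Or.inr ⟨rfl, h2⟩)

/-! ### Continued fractions and the cells containing x. -/

/-- `z t` is the tail `[0; a_t, a_{t+1}, …]` of the continued fraction with partial quotients
`a_0, a_1, …`. -/
structure IsExpansion (a : ℕ → ℕ) (z : ℕ → ℝ) : Prop where
  pos : ∀ t, 0 < z t
  lt_one : ∀ t, z t < 1
  one_le : ∀ t, 1 ≤ a t
  eq : ∀ t, z t * (a t + z (t + 1)) = 1

/-- The denominators of the convergents, shifted: `contDen a (t + 1) = q_t`. -/
def contDen (a : ℕ → ℕ) : ℕ → ℝ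
  | 0 => 0
  | 1 => 1
  | t + 2 => a t * contDen a (t + 1) + contDen a t

/-- The sum of the first `t` partial quotients. -/
def quotSum (a : ℕ → ℕ) (t : ℕ) : ℕ := ∑ i ∈ Finset.range t, a i

theorem quotSum_succ (a : ℕ → ℕ) (t : ℕ) : quotSum a (t + 1) = quotSum a t + a t :=
  Finset.sum_range_succ _ _

theorem contDen_nonneg (a : ℕ → ℕ) (t : ℕ) : 0 ≤ contDen a t := by
  induction t using contDen.induct with
  | case1 => simp [contDen]
  | case2 => simp [contDen]
  | case3 t h1 h2 => rw [contDen]; positivity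

theorem contDen_le_succ {a : ℕ → ℕ} (ha : ∀ t, 1 ≤ a t) (t : ℕ) :
    contDen a t ≤ contDen a (t + 1) := by
  cases t with
  | zero => simp [contDen]
  | succ t =>
    rw [contDen]
    have h1 : (1 : ℝ) ≤ a t := by exact_mod_cast ha t
    nlinarith [contDen_nonneg a t, contDen_nonneg a (t + 1)]

theorem quotSum_mono (a : ℕ → ℕ) : Monotone (quotSum a) :=
  monotone_nat_of_le_succ fun t => by rw [quotSum_succ]; omega

variable {a : ℕ → ℕ} {z : ℕ → ℝ}

theorem IsExpansion.mul_lt_one (h : IsExpansion a z) {t k : ℕ} (hk : k ≤ a t) : k * z t < 1 := by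
  have h1 := h.eq t
  have h2 := mul_pos (h.pos t) (h.pos (t + 1))
  have h3 : (k : ℝ) ≤ a t := by exact_mod_cast hk
  nlinarith [h.pos t]

/-- A is the last convergent and B the current intermediate fraction, on either side of x. Since x
is the combination of A and B with weights 1 - k z_t and z_t, both positive, it lies between them.
Level 0 corresponds to t = 0, k = 1, hence n + 1 on the left of the level count. -/
theorem IsExpansion.exists_stern_brocot (h : IsExpansion a z) (n : ℕ) :
    ∃ t k j : ℕ, 1 ≤ k ∧ k ≤ a t ∧ n + 1 = quotSum a t + k ∧ j < 2 ^ n ∧ ∃ A B : ℕ × ℕ,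
      ((A = sternBrocot n j ∧ B = sternBrocot n (j + 1)) ∨
        (A = sternBrocot n (j + 1) ∧ B = sternBrocot n j)) ∧
      (A.2 : ℝ) = contDen a (t + 1) ∧ (B.2 : ℝ) = k * contDen a (t + 1) + contDen a t ∧
      z 0 * ((1 - k * z t) * A.2 + z t * B.2) = (1 - k * z t) * A.1 + z t * B.1 := by
  induction n with
  | zero =>
    refine ⟨0, 1, 0, le_rfl, h.one_le 0, by simp [quotSum], by simp, (0, 1), (1, 1),
      Or.inl ⟨by simp [sternBrocot], by simp [sternBrocot]⟩, by simp [contDen], by simp [contDen],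
      by push_cast; ring⟩
  | succ n ih =>
    obtain ⟨t, k, j, hk1, hk, hn, hj, A, B, hAB, hA, hB, hx⟩ := ih
    have hj' : 2 * j + 1 < 2 ^ (n + 1) := by rw [pow_succ]; omega
    have h2 : sternBrocot (n + 1) (2 * j + 1 + 1) = sternBrocot n (j + 1) :=
      sternBrocot_even n (j + 1)
    rcases hk.lt_or_eq with hlt | rfl
    · have c1 : (A.2 : ℝ) = contDen a (t + 1) ∧
          (((A + B).2 : ℕ) : ℝ) = (k + 1 : ℕ) * contDen a (t + 1) + contDen a t ∧
          z 0 * ((1 - (k + 1 : ℕ) * z t) * A.2 + z t * (A + B).2) =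
            (1 - (k + 1 : ℕ) * z t) * A.1 + z t * (A + B).1 := by
        refine ⟨hA, ?_, ?_⟩
        · push_cast [Prod.snd_add]; rw [hA, hB]; ring
        · push_cast [Prod.snd_add, Prod.fst_add]; linear_combination hx
      rcases hAB with ⟨e1, e2⟩ | ⟨e1, e2⟩
      · refine ⟨t, k + 1, 2 * j, by omega, hlt, by omega, by omega, A, A + B, Or.inl ⟨?_, ?_⟩, c1⟩
        · rw [sternBrocot_even, e1]
        · rw [sternBrocot_odd, e1, e2]
      · refine ⟨t, k + 1, 2 * j + 1, by omega, hlt, by omega, by omega, A, A + B,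
          Or.inr ⟨?_, ?_⟩, c1⟩
        · rw [h2, e1]
        · rw [sternBrocot_odd, e1, e2, add_comm]
    -- The quotient is used up, so B is the next convergent and takes over the role of A. The
    -- weights are rescaled by z_t, using 1 - a_t z_t = z_t z_{t+1}.
    · have c1 : (B.2 : ℝ) = contDen a (t + 1 + 1) ∧
          (((A + B).2 : ℕ) : ℝ) = (1 : ℕ) * contDen a (t + 1 + 1) + contDen a (t + 1) ∧
          z 0 * ((1 - (1 : ℕ) * z (t + 1)) * B.2 + z (t + 1) * (A + B).2) =
            (1 - (1 : ℕ) * z (t + 1)) * B.1 + z (t + 1) * (A + B).1 := by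
        refine ⟨hB, ?_, ?_⟩
        · push_cast [Prod.snd_add]; rw [hA, hB, contDen]; ring
        · have hz := (h.pos t).ne'
          have e := h.eq t
          apply mul_left_cancel₀ hz
          push_cast [Prod.snd_add, Prod.fst_add]
          linear_combination hx + (z 0 * A.2 - A.1) * e
      have hn' : n + 1 + 1 = quotSum a (t + 1) + 1 := by rw [quotSum_succ]; omega
      rcases hAB with ⟨e1, e2⟩ | ⟨e1, e2⟩
      · refine ⟨t + 1, 1, 2 * j + 1, le_rfl, h.one_le _, hn', by omega, B, A + B,
          Or.inr ⟨?_, ?_⟩, c1⟩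
        · rw [h2, e2]
        · rw [sternBrocot_odd, e1, e2]
      · refine ⟨t + 1, 1, 2 * j, le_rfl, h.one_le _, hn', by omega, B, A + B,
          Or.inl ⟨?_, ?_⟩, c1⟩
        · rw [sternBrocot_even, e2]
        · rw [sternBrocot_odd, e1, e2, add_comm]

theorem inCell_of_combination {n j : ℕ} {x α β : ℝ} (hj : j < 2 ^ n) (hα : 0 < α) (hβ : 0 < β)
    (h : x * (α * (sternBrocot n j).2 + β * (sternBrocot n (j + 1)).2) =
      α * (sternBrocot n j).1 + β * (sternBrocot n (j + 1)).1) : InCell n j x := by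
  have e := sternBrocot_unimodular n j hj
  have e' : ((sternBrocot n (j + 1)).1 : ℝ) * (sternBrocot n j).2 =
      (sternBrocot n j).1 * (sternBrocot n (j + 1)).2 + 1 := by exact_mod_cast e
  have d0 : (0 : ℝ) < (sternBrocot n j).2 := by exact_mod_cast sternBrocot_den_pos n j
  have d1 : (0 : ℝ) < (sternBrocot n (j + 1)).2 := by exact_mod_cast sternBrocot_den_pos n (j + 1)
  refine ⟨hj, ?_, ?_⟩
  · rw [node, div_lt_iff₀ d0]
    have : 0 < α * (sternBrocot n j).2 + β * (sternBrocot n (j + 1)).2 := by positivity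
    refine lt_of_mul_lt_mul_left ?_ this.le
    have : (α * (sternBrocot n j).2 + β * (sternBrocot n (j + 1)).2) *
        (x * (sternBrocot n j).2) = (α * (sternBrocot n j).1 + β * (sternBrocot n (j + 1)).1) *
        (sternBrocot n j).2 := by rw [← h]; ring
    rw [this]
    linear_combination (exp := 1) hβ - β * e'
  · rw [node, lt_div_iff₀ d1]
    have : 0 < α * (sternBrocot n j).2 + β * (sternBrocot n (j + 1)).2 := by positivity
    refine lt_of_mul_lt_mul_left ?_ this.le
    have : (α * (sternBrocot n j).2 + β * (sternBrocot n (j + 1)).2) *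
        (x * (sternBrocot n (j + 1)).2) = (α * (sternBrocot n j).1 +
        β * (sternBrocot n (j + 1)).1) * (sternBrocot n (j + 1)).2 := by rw [← h]; ring
    rw [this]
    linear_combination (exp := 1) hα - α * e'

theorem IsExpansion.exists_inCell (h : IsExpansion a z) (n : ℕ) :
    ∃ t k j : ℕ, 1 ≤ k ∧ k ≤ a t ∧ n + 1 = quotSum a t + k ∧ InCell n j (z 0) ∧
      ((den n j = contDen a (t + 1) ∧ den n (j + 1) = k * contDen a (t + 1) + contDen a t) ∨
       (den n j = k * contDen a (t + 1) + contDen a t ∧ den n (j + 1) = contDen a (t + 1))) := by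
  obtain ⟨t, k, j, hk1, hk, hn, hj, A, B, hAB, hA, hB, hx⟩ := h.exists_stern_brocot n
  have hpos := h.mul_lt_one hk
  have hz := h.pos t
  refine ⟨t, k, j, hk1, hk, hn, ?_, ?_⟩
  · rcases hAB with ⟨rfl, rfl⟩ | ⟨rfl, rfl⟩
    · exact inCell_of_combination hj (by linarith) hz hx
    · exact inCell_of_combination (α := z t) (β := 1 - k * z t) hj hz (by linarith)
        (by linear_combination hx)
  · rcases hAB with ⟨rfl, rfl⟩ | ⟨rfl, rfl⟩
    · exact Or.inl ⟨hA, hB⟩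
    · exact Or.inr ⟨hB, hA⟩

/-- Links the abstract tails with the expansion that defines `partialQuotient`. -/
theorem IsExpansion.stream (h : IsExpansion a z) (t : ℕ) :
    ∃ b : ℤ, GenContFract.IntFractPair.stream (z 0) t = some ⟨b, z t⟩ := by
  induction t with
  | zero =>
    refine ⟨⌊z 0⌋, ?_⟩
    rw [GenContFract.IntFractPair.stream_zero, GenContFract.IntFractPair.of,
      Int.fract_eq_self.2 ⟨(h.pos 0).le, h.lt_one 0⟩]
  | succ t ih =>
    obtain ⟨b, hb⟩ := ih
    refine ⟨⌊(z t)⁻¹⌋, ?_⟩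
    rw [GenContFract.IntFractPair.stream_succ_of_some hb (h.pos t).ne']
    have e : (z t)⁻¹ = a t + z (t + 1) := inv_eq_of_mul_eq_one_right (h.eq t)
    simp only [GenContFract.IntFractPair.of, e, Int.fract_natCast_add,
      Int.fract_eq_self.2 ⟨(h.pos (t + 1)).le, h.lt_one (t + 1)⟩]

theorem IsExpansion.get? (h : IsExpansion a z) (t : ℕ) :
    (GenContFract.of (z 0)).s.get? t = some ⟨1, (a t : ℝ)⟩ := by
  obtain ⟨b, hb⟩ := h.stream t
  have h1 := GenContFract.IntFractPair.stream_succ_of_some hb (h.pos t).ne'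
  have e : (z t)⁻¹ = a t + z (t + 1) := inv_eq_of_mul_eq_one_right (h.eq t)
  rw [GenContFract.get?_of_eq_some_of_succ_get?_intFractPair_stream h1]
  have : ⌊z (t + 1)⌋ = 0 := Int.floor_eq_zero_iff.2 ⟨(h.pos (t + 1)).le, h.lt_one (t + 1)⟩
  simp [GenContFract.IntFractPair.of, e, this]

theorem IsExpansion.irrational (h : IsExpansion a z) : Irrational (z 0) := by
  rintro ⟨q, hq⟩
  obtain ⟨n, hn⟩ := (GenContFract.terminates_iff_rat (z 0)).2 ⟨q, hq.symm⟩
  have : (GenContFract.of (z 0)).s.get? n = none := hn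
  rw [h.get? n] at this
  simp at this

theorem IsExpansion.S_eq (h : IsExpansion a z) (t : ℕ) : S (z 0) t = quotSum a t := by
  rw [S, quotSum, Nat.cast_sum]
  refine Finset.sum_congr rfl fun i _ => ?_
  rw [partialQuotient, GenContFract.partDens, Stream'.Seq.map_get?, h.get? i]
  simp

theorem exists_isExpansion_of_irrational {x : ℝ} (hx : Irrational x) (h0 : 0 < x) (h1 : x < 1) :
    ∃ a z, IsExpansion a z ∧ z 0 = x := by
  let z : ℕ → ℝ := fun t => Nat.rec x (fun _ y => Int.fract y⁻¹) t
  have hz : ∀ t, z (t + 1) = Int.fract (z t)⁻¹ := fun _ => rfl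
  have key : ∀ t, Irrational (z t) ∧ 0 < z t ∧ z t < 1 := by
    intro t
    induction t with
    | zero => exact ⟨hx, h0, h1⟩
    | succ t ih =>
      obtain ⟨i1, -, -⟩ := ih
      have i4 : Irrational (z (t + 1)) := by
        rw [hz, Int.fract]; exact (irrational_inv_iff.2 i1).sub_intCast _
      exact ⟨i4, lt_of_le_of_ne (Int.fract_nonneg _) i4.ne_zero.symm, Int.fract_lt_one _⟩
  refine ⟨fun t => ⌊(z t)⁻¹⌋₊, z, ⟨fun t => (key t).2.1, fun t => (key t).2.2, ?_, ?_⟩, rfl⟩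
  · intro t
    obtain ⟨-, i2, i3⟩ := key t
    exact Nat.le_floor (by simpa using (one_le_inv₀ i2).2 i3.le)
  · intro t
    obtain ⟨-, i2, -⟩ := key t
    rw [hz, natCast_floor_eq_intCast_floor (inv_pos.2 i2).le, Int.floor_add_fract,
      mul_inv_cancel₀ i2.ne']

/-- Compactness of the cube [0,1]^ℕ: the sequences solving the first N tail equations form nested
nonempty closed sets, and a common point solves all of them. -/
theorem exists_isExpansion (ha : ∀ t, 1 ≤ a t) : ∃ z, IsExpansion a z := by
  let K : Set (ℕ → ℝ) := Set.univ.pi fun _ => Set.Icc 0 1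
  let C : ℕ → Set (ℕ → ℝ) := fun N => K ∩ {z | ∀ t < N, z t * (a t + z (t + 1)) = 1}
  have hK : IsCompact K := isCompact_univ_pi fun _ => isCompact_Icc
  have hclosed : ∀ N, IsClosed (C N) := by
    intro N
    refine hK.isClosed.inter ?_
    have e : {z : ℕ → ℝ | ∀ t < N, z t * (a t + z (t + 1)) = 1} =
        ⋂ t, ⋂ (_ : t < N), {z : ℕ → ℝ | z t * (a t + z (t + 1)) = 1} := by ext; simp
    rw [e]
    refine isClosed_iInter fun t => isClosed_iInter fun _ => ?_
    exact isClosed_eq (by fun_prop) continuous_const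
  have hsucc : ∀ N, C (N + 1) ⊆ C N := fun N z hz => ⟨hz.1, fun t ht => hz.2 t (by omega)⟩
  have hne : ∀ N, (C N).Nonempty := by
    intro N
    suffices H : ∀ (N : ℕ) (b : ℕ → ℕ), (∀ t, 1 ≤ b t) →
        ∃ z : ℕ → ℝ, (∀ t, 0 ≤ z t ∧ z t ≤ 1) ∧ ∀ t < N, z t * (b t + z (t + 1)) = 1 by
      obtain ⟨z, hz, hz'⟩ := H N a ha
      exact ⟨z, fun t _ => hz t, hz'⟩
    intro N
    induction N with
    | zero => exact fun b _ => ⟨0, by simp, by simp⟩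
    | succ N ih =>
      intro b hb
      obtain ⟨z, hz, hz'⟩ := ih (fun t => b (t + 1)) fun t => hb (t + 1)
      have hb0 : (1 : ℝ) ≤ b 0 := by exact_mod_cast hb 0
      have hpos : 1 ≤ (b 0 : ℝ) + z 0 := by linarith [(hz 0).1]
      refine ⟨fun t => Nat.casesOn t ((b 0 : ℝ) + z 0)⁻¹ z, ?_, ?_⟩
      · rintro (_ | t)
        · exact ⟨inv_nonneg.2 (by linarith), inv_le_one_of_one_le₀ hpos⟩
        · exact hz t
      · rintro (_ | t) ht
        · exact inv_mul_cancel₀ (zero_lt_one.trans_le hpos).ne'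
        · exact hz' t (by omega)
  obtain ⟨z, hz⟩ := IsCompact.nonempty_iInter_of_sequence_nonempty_isCompact_isClosed C hsucc hne
    (hK.of_isClosed_subset (hclosed 0) fun z hz => hz.1) hclosed
  rw [Set.mem_iInter] at hz
  have heq : ∀ t, z t * (a t + z (t + 1)) = 1 := fun t => (hz (t + 1)).2 t (by omega)
  have h0 : ∀ t, 0 ≤ z t := fun t => ((hz 0).1 t trivial).1
  have hpos : ∀ t, 0 < z t := fun t => lt_of_le_of_ne (h0 t) fun h => by
    have := heq t; rw [← h] at this; simp at this
  refine ⟨z, hpos, fun t => ?_, ha, heq⟩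
  have h1 : (1 : ℝ) ≤ a t := by exact_mod_cast ha t
  nlinarith [hpos t, hpos (t + 1), heq t, mul_pos (hpos t) (hpos (t + 1))]

/-- While q_t is the convergent denominator of the cell, the level stays below S_{t+1} and the
product of denominators is at least q_t². -/
theorem IsExpansion.hasDerivAtTop (h : IsExpansion a z)
    (hq : Tendsto (fun t => contDen a (t + 1) ^ 2 / 2 ^ quotSum a (t + 1)) atTop atTop) :
    HasDerivAtTop questionMark (z 0) := by
  refine hasDerivAtTop_questionMark h.irrational
    (fun n => by obtain ⟨_, _, j, -, -, -, hj, -⟩ := h.exists_inCell n; exact ⟨j, hj⟩) fun C => ?_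
  obtain ⟨T, hT⟩ := eventually_atTop.1 (tendsto_atTop.1 hq (max C 0))
  refine ⟨quotSum a T, fun n hn i hi => ?_⟩
  obtain ⟨t, k, j, hk1, hk, hnk, hj, hden⟩ := h.exists_inCell n
  obtain rfl := hi.unique hj
  have hTt : T ≤ t := by
    by_contra! hc
    have := quotSum_mono a (show t + 1 ≤ T by omega)
    rw [quotSum_succ] at this
    omega
  have hC := hT t hTt
  rw [le_div_iff₀ (by positivity)] at hC
  have e1 : den n i * den n (i + 1) = contDen a (t + 1) * (k * contDen a (t + 1) + contDen a t) := by
    rcases hden with ⟨e1, e2⟩ | ⟨e1, e2⟩ <;> rw [e1, e2]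
    ring
  rw [e1]
  have h1 := contDen_nonneg a t
  have h2 := contDen_nonneg a (t + 1)
  have h3 : (1 : ℝ) ≤ k := by exact_mod_cast hk1
  calc C * 2 ^ n ≤ max C 0 * 2 ^ quotSum a (t + 1) := by
        gcongr
        · exact le_max_left _ _
        · norm_num
        · rw [quotSum_succ]; omega
    _ ≤ contDen a (t + 1) * (1 * contDen a (t + 1) + 0) := by linarith
    _ ≤ _ := by gcongr

theorem add_two_sq_le (k : ℕ) : (((k + 1 : ℕ) : ℝ) + 2) ^ 2 ≤ 16 * 2 ^ k := by
  induction k with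
  | zero => norm_num
  | succ k ih =>
    rcases Nat.eq_zero_or_pos k with rfl | hk
    · norm_num
    · have : (1 : ℝ) ≤ k := by exact_mod_cast hk
      rw [pow_succ (2 : ℝ) k]; push_cast at ih ⊢; nlinarith

/-- At level S_t + m the denominators sum to at most (m+3) q_t, and (m+3)² is absorbed by 2^m; this
is why S_t rather than S_{t+1} suffices. -/
theorem IsExpansion.hasDerivAt_zero (h : IsExpansion a z)
    (hq : Tendsto (fun t => contDen a (t + 1) ^ 2 / 2 ^ quotSum a t) atTop (𝓝 0)) :
    HasDerivAt questionMark 0 (z 0) := by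
  refine hasDerivAt_questionMark_zero h.irrational
    (fun n => by obtain ⟨_, _, j, -, -, -, hj, -⟩ := h.exists_inCell n; exact ⟨j, hj⟩) fun ε hε => ?_
  obtain ⟨T, hT⟩ := eventually_atTop.1 (hq.eventually_le_const (show 0 < ε / 16 by positivity))
  refine ⟨quotSum a T, fun n hn i hi => ?_⟩
  obtain ⟨t, k, j, hk1, hk, hnk, hj, hden⟩ := h.exists_inCell n
  obtain rfl := hi.unique hj
  have hTt : T ≤ t := by
    by_contra! hc
    have := quotSum_mono a (show t + 1 ≤ T by omega)
    rw [quotSum_succ] at this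
    omega
  have hC := hT t hTt
  rw [div_le_iff₀ (by positivity)] at hC
  have e1 : den n i + den n (i + 1) = contDen a (t + 1) + (k * contDen a (t + 1) + contDen a t) := by
    rcases hden with ⟨e1, e2⟩ | ⟨e1, e2⟩ <;> rw [e1, e2]
    ring
  rw [e1]
  have h1 := contDen_nonneg a t
  have h2 := contDen_nonneg a (t + 1)
  have h4 := contDen_le_succ h.one_le t
  obtain ⟨m, rfl⟩ : ∃ m, k = m + 1 := ⟨k - 1, by omega⟩
  obtain rfl : n = quotSum a t + m := by omega
  calc (contDen a (t + 1) + ((m + 1 : ℕ) * contDen a (t + 1) + contDen a t)) ^ 2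
      ≤ ((((m + 1 : ℕ) : ℝ) + 2) * contDen a (t + 1)) ^ 2 := by gcongr; linarith
    _ = (((m + 1 : ℕ) : ℝ) + 2) ^ 2 * contDen a (t + 1) ^ 2 := by ring
    _ ≤ (16 * 2 ^ m) * (ε / 16 * 2 ^ quotSum a t) := by gcongr; exact add_two_sq_le m
    _ = ε * 2 ^ (quotSum a t + m) := by rw [pow_add]; ring

/-! ### The numbers λ_j, concavity of log λ_j, and κ₁, κ₂. -/

theorem lam_sq (j : ℕ) : lam j ^ 2 = j * lam j + 1 := by
  have h : √((j : ℝ) ^ 2 + 4) ^ 2 = (j : ℝ) ^ 2 + 4 := Real.sq_sqrt (by positivity)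
  unfold lam
  linear_combination h / 4

theorem one_le_lam (j : ℕ) : 1 ≤ lam j := by
  have h : 2 ≤ √((j : ℝ) ^ 2 + 4) := Real.le_sqrt_of_sq_le (by nlinarith [sq_nonneg (j : ℝ)])
  have : (0 : ℝ) ≤ j := by positivity
  unfold lam
  linarith

theorem lam_pos (j : ℕ) : 0 < lam j := zero_lt_one.trans_le (one_le_lam j)

theorem lam_mono {i j : ℕ} (h : i ≤ j) : lam i ≤ lam j := by
  have : (i : ℝ) ≤ j := by exact_mod_cast h
  unfold lam
  gcongr

theorem lam_le_add_one (j : ℕ) : lam j ≤ j + 1 := by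
  have hj : (0 : ℝ) ≤ j := by positivity
  have h : √((j : ℝ) ^ 2 + 4) ≤ j + 2 := Real.sqrt_le_iff.2 ⟨by positivity, by nlinarith⟩
  unfold lam
  linarith

theorem log_lam_nonneg (j : ℕ) : 0 ≤ Real.log (lam j) := Real.log_nonneg (one_le_lam j)

theorem exp_log_lam (j : ℕ) : Real.exp (Real.log (lam j)) = lam j := Real.exp_log (lam_pos j)

theorem log_lam (j : ℕ) : Real.log (lam j) = Real.arsinh (j / 2) := by
  have h : √((j : ℝ) ^ 2 + 4) = 2 * √(1 + ((j : ℝ) / 2) ^ 2) := by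
    rw [show (j : ℝ) ^ 2 + 4 = 2 ^ 2 * (1 + ((j : ℝ) / 2) ^ 2) by ring,
      Real.sqrt_mul (by positivity), Real.sqrt_sq (by norm_num)]
  have e : lam j = Real.exp (Real.arsinh (j / 2)) := by
    rw [Real.exp_arsinh, lam, h]; ring
  rw [e, Real.log_exp]

theorem concaveOn_arsinh : ConcaveOn ℝ (Set.Ici 0) Real.arsinh := by
  refine AntitoneOn.concaveOn_of_deriv (convex_Ici 0) Real.continuous_arsinh.continuousOn
    Real.differentiable_arsinh.differentiableOn ?_
  rw [interior_Ici]
  intro x hx y hy hxy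
  rw [(Real.hasDerivAt_arsinh x).deriv, (Real.hasDerivAt_arsinh y).deriv]
  have : (0 : ℝ) < x := hx
  gcongr

theorem log_lam_sub_le {i j k : ℕ} (hij : i < j) (hjk : j < k) :
    (Real.log (lam k) - Real.log (lam j)) * ((j : ℝ) - i) ≤
      (Real.log (lam j) - Real.log (lam i)) * ((k : ℝ) - j) := by
  have h1 : (i : ℝ) < j := by exact_mod_cast hij
  have h2 : (j : ℝ) < k := by exact_mod_cast hjk
  have h := concaveOn_arsinh.slope_anti_adjacent (x := (i : ℝ) / 2) (y := (j : ℝ) / 2)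
    (z := (k : ℝ) / 2) (by simp; positivity) (by simp; positivity) (by linarith) (by linarith)
  rw [div_le_div_iff₀ (by linarith) (by linarith)] at h
  rw [log_lam, log_lam, log_lam]
  linarith

/-- The slope of `j ↦ log λ_j` between `4` and `5`. -/
noncomputable def lamSlope : ℝ := Real.log (lam 5) - Real.log (lam 4)

/-- The intercept at `0` of the chord of `j ↦ log λ_j` between `4` and `5`. -/
noncomputable def lamIntercept : ℝ := 5 * Real.log (lam 4) - 4 * Real.log (lam 5)

/-- A concave function lies below the extension of a chord outside the chord's interval, and no
integer lies strictly between 4 and 5. -/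
theorem log_lam_le (j : ℕ) : Real.log (lam j) ≤ lamIntercept + j * lamSlope := by
  unfold lamIntercept lamSlope
  rcases lt_or_ge j 4 with h | h
  · have := log_lam_sub_le h (show 4 < 5 by norm_num)
    push_cast at this; linarith
  · rcases h.eq_or_lt with rfl | h
    · push_cast; linarith
    · rcases (show 5 ≤ j from h).eq_or_lt with rfl | h
      · push_cast; linarith
      · have := log_lam_sub_le (show 4 < 5 by norm_num) h
        push_cast at this; linarith

theorem log_lam_eq {j : ℕ} (hj : j = 4 ∨ j = 5) :
    Real.log (lam j) = lamIntercept + j * lamSlope := by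
  unfold lamIntercept lamSlope
  rcases hj with rfl | rfl <;> push_cast <;> ring

theorem lam_four_bounds : 4.2 ≤ lam 4 ∧ lam 4 ≤ 4.24 := by
  have h := lam_sq 4
  have h0 := lam_pos 4
  push_cast at h
  constructor <;> nlinarith

theorem lam_five_le : lam 5 ≤ 5.2 := by
  have h := lam_sq 5
  have h0 := lam_pos 5
  push_cast at h
  nlinarith

theorem log_sqrt_two : Real.log √2 = Real.log 2 / 2 := Real.log_sqrt (by norm_num)

theorem lamSlope_nonneg : 0 ≤ lamSlope := by
  have := Real.log_le_log (lam_pos 4) (lam_mono (show 4 ≤ 5 by norm_num))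
  unfold lamSlope; linarith

theorem lamSlope_lt : lamSlope < Real.log 2 / 2 := by
  have h4 := lam_four_bounds
  have h5 := lam_five_le
  have h : Real.log (lam 5 ^ 2) < Real.log (2 * lam 4 ^ 2) :=
    Real.log_lt_log (by have := lam_pos 5; positivity) (by
      have := lam_pos 5
      nlinarith)
  rw [Real.log_mul (by norm_num) (by have := lam_pos 4; positivity), Real.log_pow,
    Real.log_pow] at h
  unfold lamSlope
  push_cast at h
  linarith

/-- The form in which κ₂ is used: the chord through 4 and 5 takes the value κ₂ log √2 at κ₂. -/
theorem kappa2_mul : kappa2 * (Real.log 2 / 2 - lamSlope) = lamIntercept := by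
  have h := lamSlope_lt
  rw [kappa2, log_sqrt_two, lamIntercept]
  unfold lamSlope at *
  rw [div_mul_eq_mul_div, div_eq_iff (by linarith)]
  ring

theorem four_lt_kappa2 : 4 < kappa2 := by
  have h := lamSlope_lt
  have e := kappa2_mul
  have h4 : Real.log ((2 : ℝ) ^ 2) < Real.log (lam 4) :=
    Real.log_lt_log (by norm_num) (by linarith [lam_four_bounds.1])
  rw [Real.log_pow] at h4
  push_cast at h4
  by_contra! hc
  have := mul_le_mul_of_nonneg_right hc (show 0 ≤ Real.log 2 / 2 - lamSlope by linarith)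
  unfold lamIntercept lamSlope at *
  linarith

theorem kappa2_lt_five : kappa2 < 5 := by
  have h := lamSlope_lt
  have e := kappa2_mul
  have h5 : Real.log (lam 5 ^ 2) < Real.log ((2 : ℝ) ^ 5) :=
    Real.log_lt_log (by have := lam_pos 5; positivity)
      (by nlinarith [lam_five_le, lam_pos 5])
  rw [Real.log_pow, Real.log_pow] at h5
  push_cast at h5
  by_contra! hc
  have := mul_le_mul_of_nonneg_right hc (show 0 ≤ Real.log 2 / 2 - lamSlope by linarith)
  unfold lamIntercept lamSlope at *
  linarith

theorem log_two_pos : 0 < Real.log 2 := Real.log_pos (by norm_num)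

theorem kappa1_mul : kappa1 * Real.log 2 = 2 * Real.log (lam 1) := by
  rw [kappa1, div_mul_cancel₀ _ log_two_pos.ne']

theorem one_lt_kappa1 : 1 < kappa1 := by
  have h2 : Real.log 2 < Real.log (lam 1 ^ 2) := Real.log_lt_log (by norm_num) (by
    have h := lam_sq 1
    have := one_le_lam 1
    push_cast at h
    nlinarith)
  rw [Real.log_pow] at h2
  push_cast at h2
  rw [kappa1, lt_div_iff₀ log_two_pos]
  linarith

/-! ### Bounds for the convergent denominators. -/

/-- The Euclidean operator norm of the matrix `(a, 1; 1, 0)` is `λ_a`. -/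
theorem sq_add_sq_le_lam (j : ℕ) (u v : ℝ) :
    (j * u + v) ^ 2 + u ^ 2 ≤ lam j ^ 2 * (u ^ 2 + v ^ 2) := by
  have h := lam_sq j
  have hl := lam_pos j
  have hj : (j : ℝ) = lam j - 1 / lam j := by field_simp; linarith
  have hj0 : (0 : ℝ) ≤ j := by positivity
  have key : lam j ^ 2 * (u ^ 2 + v ^ 2) - ((j * u + v) ^ 2 + u ^ 2) =
      j * (lam j * (u / lam j - v) ^ 2) := by
    rw [hj]; field_simp; ring
  have : 0 ≤ j * (lam j * (u / lam j - v) ^ 2) := by positivity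
  linarith

theorem contDen_sq_le (a : ℕ → ℕ) (t : ℕ) :
    contDen a (t + 1) ^ 2 + contDen a t ^ 2 ≤
      Real.exp (∑ i ∈ Finset.range t, Real.log (lam (a i))) ^ 2 := by
  induction t with
  | zero => simp [contDen]
  | succ t ih =>
    rw [Finset.sum_range_succ, Real.exp_add, exp_log_lam, contDen]
    refine (sq_add_sq_le_lam (a t) _ _).trans ?_
    rw [mul_pow, mul_comm]
    gcongr

theorem contDen_le_exp (a : ℕ → ℕ) (t : ℕ) :
    contDen a (t + 1) ≤ Real.exp (∑ i ∈ Finset.range t, Real.log (lam (a i))) :=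
  le_of_sq_le_sq ((le_add_of_nonneg_right (sq_nonneg _)).trans (contDen_sq_le a t))
    (Real.exp_pos _).le

theorem lam_one_pow_le (ha : ∀ t, 1 ≤ a t) (t : ℕ) :
    lam 1 ^ t ≤ lam 1 * contDen a (t + 1) := by
  have hl := lam_pos 1
  have h1 := lam_sq 1
  push_cast at h1
  -- (λ_1, 1) is an eigenvector, with eigenvalue λ_1, of the symmetric matrix (1, 1; 1, 0), so for
  -- quotients equal to 1 this holds with equality.
  have key : ∀ t, lam 1 ^ (t + 1) ≤ lam 1 * contDen a (t + 1) + contDen a t := by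
    intro t
    induction t with
    | zero => simp [contDen]
    | succ t ih =>
      rw [contDen, pow_succ]
      have h2 : (1 : ℝ) ≤ a t := by exact_mod_cast ha t
      have h3 := contDen_nonneg a (t + 1)
      have h4 := mul_le_mul_of_nonneg_right ih hl.le
      have h5 : contDen a (t + 1) ≤ a t * contDen a (t + 1) := le_mul_of_one_le_left h3 h2
      have h6 := mul_le_mul_of_nonneg_left h5 hl.le
      nlinarith
  have h2 := key t
  have h3 := contDen_le_succ ha t
  refine le_of_mul_le_mul_left ?_ hl
  rw [pow_succ] at h2
  have e : lam 1 * (lam 1 * contDen a (t + 1)) = lam 1 * contDen a (t + 1) + contDen a (t + 1) := by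
    linear_combination contDen a (t + 1) * h1
  linarith

theorem two_pow_eq_exp (n : ℕ) : (2 : ℝ) ^ n = Real.exp (n * Real.log 2) := by
  rw [mul_comm, Real.exp_mul, Real.exp_log (by norm_num), Real.rpow_natCast]

theorem IsExpansion.hasDerivAtTop_of_exp_le (h : IsExpansion a z) {g : ℕ → ℝ}
    (hg : ∀ t, Real.exp (g t) ≤ contDen a (t + 1))
    (hlim : Tendsto (fun t => 2 * g t - quotSum a (t + 1) * Real.log 2) atTop atTop) :
    HasDerivAtTop questionMark (z 0) := by
  refine h.hasDerivAtTop (tendsto_atTop_mono (fun t => ?_) (Real.tendsto_exp_atTop.comp hlim))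
  rw [two_pow_eq_exp, Function.comp, Real.exp_sub]
  gcongr
  rw [two_mul, Real.exp_add, ← sq]
  gcongr
  exact hg t

theorem IsExpansion.hasDerivAt_zero_of_le_exp (h : IsExpansion a z) {g : ℕ → ℝ}
    (hg : ∀ t, contDen a (t + 1) ≤ Real.exp (g t))
    (hlim : Tendsto (fun t => quotSum a t * Real.log 2 - 2 * g t) atTop atTop) :
    HasDerivAt questionMark 0 (z 0) := by
  refine h.hasDerivAt_zero (squeeze_zero (fun t => by positivity) (fun t => ?_)
    (Real.tendsto_exp_neg_atTop_nhds_zero.comp hlim))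
  rw [two_pow_eq_exp, Function.comp, neg_sub, Real.exp_sub]
  gcongr
  rw [two_mul, Real.exp_add, ← sq]
  have := contDen_nonneg a (t + 1)
  gcongr
  exact hg t

/-! ### The sufficient conditions below κ₁ and above κ₂. -/

theorem hasDerivAtTop_of_limsup_lt {x : ℝ} (hx : x ∈ Set.Ioo (0 : ℝ) 1) (hirr : Irrational x)
    (hlim : limsup (fun t : ℕ => ((S x t / (t : ℝ) : ℝ) : EReal)) atTop < ((kappa1 : ℝ) : EReal)) :
    HasDerivAtTop questionMark x := by
  obtain ⟨a, z, h, rfl⟩ := exists_isExpansion_of_irrational hirr hx.1 hx.2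
  obtain ⟨c, hc1, hc2⟩ := EReal.lt_iff_exists_real_btwn.1 hlim
  have hc2 : c < kappa1 := by exact_mod_cast hc2
  have hev := eventually_lt_of_limsup_lt hc1
  refine h.hasDerivAtTop_of_exp_le (g := fun t => (t - 1) * Real.log (lam 1)) (fun t => ?_) ?_
  · have := lam_one_pow_le h.one_le t
    rw [sub_mul, Real.exp_sub, one_mul, exp_log_lam, mul_comm, Real.exp_mul, exp_log_lam,
      Real.rpow_natCast, div_le_iff₀ (lam_pos 1)]
    linarith
  · have hpos : 0 < kappa1 * Real.log 2 - c * Real.log 2 := by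
      rw [← sub_mul]; exact mul_pos (by linarith) log_two_pos
    have h1 : Tendsto (fun t : ℕ => (kappa1 * Real.log 2 - c * Real.log 2) * (t : ℝ) +
        (-c * Real.log 2 - kappa1 * Real.log 2)) atTop atTop :=
      tendsto_atTop_add_const_right _ _ (tendsto_natCast_atTop_atTop.const_mul_atTop hpos)
    refine tendsto_atTop_mono' _ ?_ h1
    filter_upwards [(tendsto_add_atTop_nat 1).eventually hev] with t ht
    have ht : S (z 0) (t + 1) / ((t + 1 : ℕ) : ℝ) < c := by exact_mod_cast ht
    rw [h.S_eq, div_lt_iff₀ (by positivity)] at ht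
    have e := kappa1_mul
    have := mul_le_mul_of_nonneg_right ht.le log_two_pos.le
    push_cast at this
    linear_combination this + (t - 1) * e

theorem sum_log_lam_le (a : ℕ → ℕ) (t : ℕ) :
    ∑ i ∈ Finset.range t, Real.log (lam (a i)) ≤ t * lamIntercept + quotSum a t * lamSlope := by
  refine (Finset.sum_le_sum fun i _ => log_lam_le (a i)).trans_eq ?_
  rw [Finset.sum_add_distrib, ← Finset.sum_mul, quotSum]
  simp

theorem hasDerivAt_zero_of_lt_liminf {x : ℝ} (hx : x ∈ Set.Ioo (0 : ℝ) 1) (hirr : Irrational x)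
    (hlim : ((kappa2 : ℝ) : EReal) < liminf (fun t : ℕ => ((S x t / (t : ℝ) : ℝ) : EReal)) atTop) :
    HasDerivAt questionMark 0 x := by
  obtain ⟨a, z, h, rfl⟩ := exists_isExpansion_of_irrational hirr hx.1 hx.2
  obtain ⟨c, hc1, hc2⟩ := EReal.lt_iff_exists_real_btwn.1 hlim
  have hc1 : kappa2 < c := by exact_mod_cast hc1
  have hev := eventually_lt_of_lt_liminf hc2
  refine h.hasDerivAt_zero_of_le_exp (fun t => (contDen_le_exp a t).trans
    (Real.exp_le_exp.2 (sum_log_lam_le a t))) ?_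
  have hD : 0 < Real.log 2 / 2 - lamSlope := by linarith [lamSlope_lt]
  have hpos : 0 < 2 * ((Real.log 2 / 2 - lamSlope) * (c - kappa2)) := by
    have := mul_pos hD (sub_pos.2 hc1)
    linarith
  refine tendsto_atTop_mono' _ ?_ (tendsto_natCast_atTop_atTop.const_mul_atTop hpos)
  filter_upwards [hev, eventually_gt_atTop 0] with t ht ht0
  have ht : c < S (z 0) t / (t : ℝ) := by exact_mod_cast ht
  rw [h.S_eq, lt_div_iff₀ (by positivity)] at ht
  have := mul_le_mul_of_nonneg_right ht.le hD.le
  have e := kappa2_mul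
  linear_combination 2 * this - 2 * t * e

/-! ### Blocks between fourth powers, and the example for κ₁. -/

/-- The integer part of the fourth root of `t`. -/
def fourthRoot (t : ℕ) : ℕ := Nat.sqrt (Nat.sqrt t)

theorem le_fourthRoot {k t : ℕ} : k ≤ fourthRoot t ↔ k ^ 4 ≤ t := by
  rw [fourthRoot, Nat.le_sqrt', Nat.le_sqrt', ← pow_mul]

theorem fourthRoot_pow_le (t : ℕ) : fourthRoot t ^ 4 ≤ t := le_fourthRoot.1 le_rfl

theorem lt_succ_fourthRoot_pow (t : ℕ) : t < (fourthRoot t + 1) ^ 4 := by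
  by_contra! h
  have := le_fourthRoot.2 h
  omega

theorem fourthRoot_mono : Monotone fourthRoot := fun _ _ h =>
  Nat.sqrt_le_sqrt (Nat.sqrt_le_sqrt h)

theorem fourthRoot_succ_le (t : ℕ) : fourthRoot (t + 1) ≤ fourthRoot t + 1 := by
  by_contra! h
  have h1 := le_fourthRoot.1 (show fourthRoot t + 2 ≤ fourthRoot (t + 1) from h)
  have h2 := lt_succ_fourthRoot_pow t
  have h3 : (fourthRoot t + 1) ^ 4 < (fourthRoot t + 2) ^ 4 := by gcongr; omega
  omega

theorem tendsto_fourthRoot : Tendsto (fun t => (fourthRoot t : ℝ)) atTop atTop :=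
  tendsto_natCast_atTop_atTop.comp <| tendsto_atTop.2 fun k =>
    (eventually_ge_atTop (k ^ 4)).mono fun _ ht => le_fourthRoot.2 ht

theorem tendsto_div_of_abs_sub_le {s : ℕ → ℝ} {κ C : ℝ} (hC : 0 ≤ C)
    (h : ∀ t, |s t - κ * t| ≤ C * ((fourthRoot t : ℝ) + 1) ^ 3) :
    Tendsto (fun t : ℕ => s t / (t : ℝ)) atTop (𝓝 κ) := by
  rw [tendsto_iff_norm_sub_tendsto_zero]
  have hlim : Tendsto (fun t => 8 * C / (fourthRoot t : ℝ)) atTop (𝓝 0) :=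
    tendsto_fourthRoot.const_div_atTop _
  refine squeeze_zero' (Eventually.of_forall fun t => norm_nonneg _) ?_ hlim
  filter_upwards [eventually_ge_atTop 1] with t ht
  have hr : 1 ≤ fourthRoot t := le_fourthRoot.2 (by simpa using ht)
  have hr' : (1 : ℝ) ≤ fourthRoot t := by exact_mod_cast hr
  have ht' : (1 : ℝ) ≤ t := by exact_mod_cast ht
  have h4 : (fourthRoot t : ℝ) ^ 4 ≤ t := by exact_mod_cast fourthRoot_pow_le t
  have e : s t / t - κ = (s t - κ * t) / t := by field_simp
  rw [e, Real.norm_eq_abs, abs_div, abs_of_pos (show (0 : ℝ) < t by linarith),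
    div_le_div_iff₀ (by linarith) (by linarith)]
  calc |s t - κ * t| * fourthRoot t
      ≤ (C * ((fourthRoot t : ℝ) + fourthRoot t) ^ 3) * fourthRoot t := by
        gcongr
        exact (h t).trans (by gcongr)
    _ = 8 * C * (fourthRoot t : ℝ) ^ 4 := by ring
    _ ≤ 8 * C * t := by gcongr

theorem tendsto_cubic_sub_quadratic_atTop {c : ℝ} (hc : 0 < c) (d e : ℝ) :
    Tendsto (fun x : ℝ => c * x ^ 3 - d * x ^ 2 - e) atTop atTop := by
  have h1 : Tendsto (fun x : ℝ => c * x + -d) atTop atTop :=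
    tendsto_atTop_add_const_right _ _ (tendsto_id.const_mul_atTop hc)
  have h2 : Tendsto (fun x : ℝ => x ^ 2) atTop atTop := tendsto_pow_atTop two_ne_zero
  refine (tendsto_atTop_add_const_right _ (-e) (h2.atTop_mul_atTop₀ h1)).congr fun x => ?_
  ring

/-- The excess `S_t - t` over a whole block, in the example for `κ₁`. -/
noncomputable def excess (θ : ℝ) (k : ℕ) : ℕ := ⌈θ * (((k : ℝ) + 1) ^ 4 + ((k : ℝ) + 1) ^ 3)⌉₊

/-- Partial quotients `1`, except for a large one at the end of each block `[k ^ 4, (k + 1) ^ 4)`. -/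
noncomputable def sparseQuot (θ : ℝ) (t : ℕ) : ℕ :=
  1 + (excess θ (fourthRoot (t + 1)) - excess θ (fourthRoot t))

theorem excess_mono {θ : ℝ} (hθ : 0 ≤ θ) : Monotone (excess θ) := fun i j h => by
  have : (i : ℝ) ≤ j := by exact_mod_cast h
  unfold excess
  gcongr

theorem quotSum_sparseQuot {θ : ℝ} (hθ : 0 ≤ θ) (t : ℕ) :
    quotSum (sparseQuot θ) t + excess θ 0 = t + excess θ (fourthRoot t) := by
  induction t with
  | zero => simp [quotSum, fourthRoot]
  | succ t ih =>
    have := excess_mono hθ (fourthRoot_mono (Nat.le_succ t))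
    rw [quotSum_succ, sparseQuot]
    simp only [Nat.succ_eq_add_one] at this
    omega

/-- Stated with differences so that it telescopes. When the root jumps, the quotient is O(r^4), and
4 log(r+2) ≤ 4(r+1) is covered by the increment 2r + 3 of (r+1)². -/
theorem log_lam_sparseQuot_le {θ : ℝ} (hθ : 0 ≤ θ) (t : ℕ) :
    Real.log (lam (sparseQuot θ t)) ≤ Real.log (lam 1) +
      (Real.log (3 + 2 * θ) + 4) *
        (((fourthRoot (t + 1) : ℝ) + 1) ^ 2 - ((fourthRoot t : ℝ) + 1) ^ 2) := by
  have h0 : 0 ≤ Real.log (3 + 2 * θ) := Real.log_nonneg (by linarith)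
  have h1 := fourthRoot_mono (Nat.le_succ t)
  rcases h1.eq_or_lt with h | h
  · have e : sparseQuot θ t = 1 := by simp [sparseQuot, ← Nat.succ_eq_add_one, ← h]
    rw [e, ← Nat.succ_eq_add_one, ← h]; simp
  · have h2 : fourthRoot (t + 1) = fourthRoot t + 1 := le_antisymm (fourthRoot_succ_le t) h
    have hle : (sparseQuot θ t : ℝ) + 1 ≤ (3 + 2 * θ) * ((fourthRoot t : ℝ) + 2) ^ 4 := by
      have e1 : (sparseQuot θ t : ℝ) ≤ 1 + excess θ (fourthRoot t + 1) := by
        rw [sparseQuot, h2]; push_cast; gcongr; exact_mod_cast Nat.sub_le _ _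
      have e2 := (Nat.ceil_lt_add_one (show 0 ≤ θ * ((((fourthRoot t + 1 : ℕ) : ℝ) + 1) ^ 4 +
        (((fourthRoot t + 1 : ℕ) : ℝ) + 1) ^ 3) by positivity)).le
      rw [← excess] at e2
      push_cast at e2
      rw [add_assoc, one_add_one_eq_two] at e2
      have hr : (1 : ℝ) ≤ (fourthRoot t : ℝ) + 2 := by
        have : (0 : ℝ) ≤ fourthRoot t := by positivity
        linarith
      have e3 : ((fourthRoot t : ℝ) + 2) ^ 3 ≤ ((fourthRoot t : ℝ) + 2) ^ 4 :=
        pow_le_pow_right₀ hr (by norm_num)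
      have e4 := mul_le_mul_of_nonneg_left e3 hθ
      have e5 : 1 ≤ ((fourthRoot t : ℝ) + 2) ^ 4 := one_le_pow₀ hr
      linarith
    have e3 : Real.log (lam (sparseQuot θ t)) ≤
        Real.log ((3 + 2 * θ) * ((fourthRoot t : ℝ) + 2) ^ 4) :=
      Real.log_le_log (lam_pos _) ((lam_le_add_one _).trans hle)
    rw [Real.log_mul (by positivity) (by positivity), Real.log_pow] at e3
    have e4 := Real.log_le_sub_one_of_pos (show 0 < (fourthRoot t : ℝ) + 2 by positivity)
    have e5 := log_lam_nonneg 1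
    rw [h2]
    push_cast at e3 ⊢
    have hr : (0 : ℝ) ≤ fourthRoot t := by positivity
    nlinarith [mul_nonneg h0 hr]

theorem sum_log_lam_sparseQuot_le {θ : ℝ} (hθ : 0 ≤ θ) (t : ℕ) :
    ∑ i ∈ Finset.range t, Real.log (lam (sparseQuot θ i)) ≤ t * Real.log (lam 1) +
      (Real.log (3 + 2 * θ) + 4) * ((fourthRoot t : ℝ) + 1) ^ 2 := by
  have h0 : 0 ≤ Real.log (3 + 2 * θ) := Real.log_nonneg (by linarith)
  induction t with
  | zero => simp; positivity
  | succ t ih =>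
    rw [Finset.sum_range_succ]
    have := log_lam_sparseQuot_le hθ t
    push_cast
    linarith

theorem exists_kappa1_hasDerivAt_zero : ∃ x : ℝ, x ∈ Set.Ioo (0 : ℝ) 1 ∧ Irrational x ∧
    Tendsto (fun t : ℕ => S x t / (t : ℝ)) atTop (𝓝 kappa1) ∧ HasDerivAt questionMark 0 x := by
  set θ := kappa1 - 1 with hθd
  have hθ : 0 < θ := by linarith [one_lt_kappa1]
  obtain ⟨z, h⟩ := exists_isExpansion (a := sparseQuot θ) fun t => by unfold sparseQuot; omega
  have hQ : ∀ t, (quotSum (sparseQuot θ) t : ℝ) = t + excess θ (fourthRoot t) - excess θ 0 := by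
    intro t
    have : ((quotSum (sparseQuot θ) t : ℝ) + excess θ 0) = t + excess θ (fourthRoot t) := by
      exact_mod_cast quotSum_sparseQuot hθ.le t
    linarith
  refine ⟨z 0, ⟨h.pos 0, h.lt_one 0⟩, h.irrational, ?_, ?_⟩
  · refine tendsto_div_of_abs_sub_le (C := 5 * θ + 1 + excess θ 0) (by positivity) fun t => ?_
    rw [h.S_eq, hQ]
    have e1 := Nat.le_ceil (θ * (((fourthRoot t : ℝ) + 1) ^ 4 + ((fourthRoot t : ℝ) + 1) ^ 3))
    have e2 := (Nat.ceil_lt_add_one (show 0 ≤ θ * (((fourthRoot t : ℝ) + 1) ^ 4 +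
      ((fourthRoot t : ℝ) + 1) ^ 3) by positivity)).le
    rw [← excess] at e1 e2
    have e3 : (fourthRoot t : ℝ) ^ 4 ≤ t := by exact_mod_cast fourthRoot_pow_le t
    have e4 : (t : ℝ) ≤ ((fourthRoot t : ℝ) + 1) ^ 4 := by
      exact_mod_cast (lt_succ_fourthRoot_pow t).le
    have hr : (0 : ℝ) ≤ fourthRoot t := by positivity
    have he : (0 : ℝ) ≤ excess θ 0 := by positivity
    generalize (excess θ 0 : ℝ) = E at *
    generalize (excess θ (fourthRoot t) : ℝ) = F at *
    generalize (fourthRoot t : ℝ) = r at *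
    have e5 := mul_le_mul_of_nonneg_left e3 hθ.le
    have e6 := mul_le_mul_of_nonneg_left e4 hθ.le
    have e7 : 1 ≤ (r + 1) ^ 3 := one_le_pow₀ (by linarith)
    have e8 : (r + 1) ^ 4 - r ^ 4 ≤ 4 * (r + 1) ^ 3 := by
      have : 0 ≤ 6 * r ^ 2 + 8 * r + 3 := by positivity
      linarith
    have e9 := mul_le_mul_of_nonneg_left e8 hθ.le
    have e10 := mul_le_mul_of_nonneg_left e7 he
    have e11 : 0 ≤ θ * (r + 1) ^ 3 := by positivity
    have e12 : kappa1 = θ + 1 := by rw [hθd]; ring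
    rw [e12, abs_le]
    constructor <;> linarith
  · refine h.hasDerivAt_zero_of_le_exp (fun t => (contDen_le_exp _ t).trans
      (Real.exp_le_exp.2 (sum_log_lam_sparseQuot_le hθ.le t))) ?_
    have hl := log_two_pos
    refine tendsto_atTop_mono (fun t => ?_) ((tendsto_cubic_sub_quadratic_atTop (mul_pos hl hθ)
      (2 * (Real.log (3 + 2 * θ) + 4)) (Real.log 2 * excess θ 0)).comp
      (tendsto_atTop_add_const_right _ 1 tendsto_fourthRoot))
    rw [hQ, Function.comp]
    have e1 := Nat.le_ceil (θ * (((fourthRoot t : ℝ) + 1) ^ 4 + ((fourthRoot t : ℝ) + 1) ^ 3))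
    rw [← excess] at e1
    -- The term (k+1)^4 in `excess` dominates t throughout the block, so S_t exceeds κ₁ t by at
    -- least θ (r+1)³ up to a constant.
    have e4 : (t : ℝ) ≤ ((fourthRoot t : ℝ) + 1) ^ 4 := by
      exact_mod_cast (lt_succ_fourthRoot_pow t).le
    have e6 := mul_le_mul_of_nonneg_left e4 hθ.le
    have e7 := kappa1_mul
    have e8 := mul_le_mul_of_nonneg_left (show θ * (t + ((fourthRoot t : ℝ) + 1) ^ 3) ≤
      excess θ (fourthRoot t) by linarith) hl.le
    have e12 : kappa1 = θ + 1 := by rw [hθd]; ring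
    rw [e12] at e7
    linear_combination e8 - t * e7

/-! ### Blocks of fours and fives, and the example for κ₂. -/

/-- The number of fives before the block `[k ^ 4, (k + 1) ^ 4)`, in the example for `κ₂`. -/
noncomputable def fivesBefore (θ : ℝ) (k : ℕ) : ℕ := ⌊θ * ((k : ℝ) ^ 4 - (k : ℝ) ^ 3)⌋₊

/-- The number of fives among the first `t` terms if `t` lies in the `k`-th block, in which all
fours come before all fives. -/
noncomputable def fivesInBlock (θ : ℝ) (k t : ℕ) : ℕ :=
  max (fivesBefore θ k) (fivesBefore θ (k + 1) - ((k + 1) ^ 4 - t))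

/-- Blocks `[k ^ 4, (k + 1) ^ 4)` of fours followed by fives. -/
noncomputable def blockQuot (θ : ℝ) (t : ℕ) : ℕ :=
  4 + (fivesInBlock θ (fourthRoot t) (t + 1) - fivesInBlock θ (fourthRoot t) t)

theorem pow_four_sub_pow_three_nonneg (k : ℕ) : 0 ≤ (k : ℝ) ^ 4 - (k : ℝ) ^ 3 := by
  rcases Nat.eq_zero_or_pos k with rfl | hk
  · simp
  · have : (1 : ℝ) ≤ k := by exact_mod_cast hk
    have : 0 ≤ (k : ℝ) ^ 3 * (k - 1) := mul_nonneg (by positivity) (by linarith)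
    linarith

theorem pow_four_sub_pow_three_le_succ (k : ℕ) :
    (k : ℝ) ^ 4 - (k : ℝ) ^ 3 ≤ ((k : ℝ) + 1) ^ 4 - ((k : ℝ) + 1) ^ 3 := by
  have : (0 : ℝ) ≤ 4 * (k : ℝ) ^ 3 + 3 * (k : ℝ) ^ 2 + k := by positivity
  linarith

theorem fivesBefore_le_succ {θ : ℝ} (hθ : 0 ≤ θ) (k : ℕ) :
    fivesBefore θ k ≤ fivesBefore θ (k + 1) := by
  have := pow_four_sub_pow_three_le_succ k
  unfold fivesBefore
  push_cast
  gcongr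

/-- A block has room for its fives because θ ≤ 1; the rounding error is less than 1 and vanishes
between integers. -/
theorem fivesBefore_succ_add_le {θ : ℝ} (hθ : 0 ≤ θ) (hθ1 : θ ≤ 1) (k : ℕ) :
    fivesBefore θ (k + 1) + k ^ 4 ≤ fivesBefore θ k + (k + 1) ^ 4 := by
  have h0 := pow_four_sub_pow_three_nonneg k
  have h1 := pow_four_sub_pow_three_nonneg (k + 1)
  have h2 := Nat.floor_le (mul_nonneg hθ h1)
  have h3 := Nat.lt_floor_add_one (θ * ((k : ℝ) ^ 4 - (k : ℝ) ^ 3))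
  rw [← fivesBefore] at h2 h3
  have h4 := pow_four_sub_pow_three_le_succ k
  have h5 : θ * ((((k : ℝ) + 1) ^ 4 - ((k : ℝ) + 1) ^ 3) - ((k : ℝ) ^ 4 - (k : ℝ) ^ 3)) ≤
      (((k : ℝ) + 1) ^ 4 - ((k : ℝ) + 1) ^ 3) - ((k : ℝ) ^ 4 - (k : ℝ) ^ 3) :=
    mul_le_of_le_one_left (by linarith) hθ1
  have h6 : (k : ℝ) ^ 3 ≤ ((k : ℝ) + 1) ^ 3 := by gcongr; linarith
  push_cast at h2
  have : ((fivesBefore θ (k + 1) + k ^ 4 : ℕ) : ℝ) < ((fivesBefore θ k + (k + 1) ^ 4 + 1 : ℕ) : ℝ) := by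
    push_cast; linarith
  have : fivesBefore θ (k + 1) + k ^ 4 < fivesBefore θ k + (k + 1) ^ 4 + 1 := by exact_mod_cast this
  omega

theorem fourthRoot_eq_or (t : ℕ) : fourthRoot (t + 1) = fourthRoot t ∨
    (fourthRoot (t + 1) = fourthRoot t + 1 ∧ t + 1 = (fourthRoot t + 1) ^ 4) := by
  have h1 := fourthRoot_mono (Nat.le_succ t)
  rcases h1.eq_or_lt with h | h
  · exact Or.inl h.symm
  · have h2 : fourthRoot (t + 1) = fourthRoot t + 1 := le_antisymm (fourthRoot_succ_le t) h
    refine Or.inr ⟨h2, le_antisymm (lt_succ_fourthRoot_pow t) ?_⟩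
    rw [← h2]; exact fourthRoot_pow_le _

/-- At a block boundary the counts of the two adjacent blocks agree, so the sum of the quotients
telescopes across blocks. -/
theorem fivesInBlock_succ {θ : ℝ} (hθ : 0 ≤ θ) (hθ1 : θ ≤ 1) (t : ℕ) :
    fivesInBlock θ (fourthRoot (t + 1)) (t + 1) = fivesInBlock θ (fourthRoot t) (t + 1) := by
  rcases fourthRoot_eq_or t with h | ⟨h1, h2⟩
  · rw [h]
  · rw [h1, h2]
    have e1 := fivesBefore_le_succ hθ (fourthRoot t)
    have e2 := fivesBefore_succ_add_le hθ hθ1 (fourthRoot t + 1)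
    unfold fivesInBlock
    omega

theorem blockQuot_spec (θ : ℝ) (t : ℕ) :
    blockQuot θ t + fivesInBlock θ (fourthRoot t) t =
      4 + fivesInBlock θ (fourthRoot t) (t + 1) ∧ (blockQuot θ t = 4 ∨ blockQuot θ t = 5) := by
  have := lt_succ_fourthRoot_pow t
  unfold blockQuot fivesInBlock
  omega

theorem blockQuot_le_succ (θ : ℝ) {t : ℕ} (h : fourthRoot (t + 1) = fourthRoot t) :
    blockQuot θ t ≤ blockQuot θ (t + 1) := by
  have h1 := lt_succ_fourthRoot_pow t
  have h2 := lt_succ_fourthRoot_pow (t + 1)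
  unfold blockQuot fivesInBlock
  rw [h] at h2 ⊢
  omega

theorem quotSum_blockQuot {θ : ℝ} (hθ : 0 ≤ θ) (hθ1 : θ ≤ 1) (t : ℕ) :
    quotSum (blockQuot θ) t = 4 * t + fivesInBlock θ (fourthRoot t) t := by
  induction t with
  | zero => simp [quotSum, fourthRoot, fivesInBlock, fivesBefore]
  | succ t ih =>
    have := (blockQuot_spec θ t).1
    rw [quotSum_succ, fivesInBlock_succ hθ hθ1]
    omega

/-- Placing the fours first keeps the count of fives lowest, so the deficit θ r³ present at the
block ends persists inside the block: the count rises with slope 1 ≥ θ towards the end. -/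
theorem fivesInBlock_bounds {θ : ℝ} (hθ : 0 ≤ θ) (hθ1 : θ ≤ 1) (t : ℕ) :
    (fourthRoot t : ℝ) ^ 3 * θ ≤ θ * t - fivesInBlock θ (fourthRoot t) t ∧
      θ * t - fivesInBlock θ (fourthRoot t) t ≤ 6 * ((fourthRoot t : ℝ) + 1) ^ 3 := by
  have e3 : (fourthRoot t : ℝ) ^ 4 ≤ t := by exact_mod_cast fourthRoot_pow_le t
  have e4 : (t : ℝ) ≤ ((fourthRoot t : ℝ) + 1) ^ 4 := by
    exact_mod_cast (lt_succ_fourthRoot_pow t).le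
  have hlt := lt_succ_fourthRoot_pow t
  have h0 := pow_four_sub_pow_three_nonneg (fourthRoot t)
  have h1 := pow_four_sub_pow_three_nonneg (fourthRoot t + 1)
  have h2 := Nat.floor_le (mul_nonneg hθ h1)
  have h3 := (Nat.lt_floor_add_one (θ * ((fourthRoot t : ℝ) ^ 4 - (fourthRoot t : ℝ) ^ 3))).le
  have h2' := Nat.floor_le (mul_nonneg hθ h0)
  rw [← fivesBefore] at h2 h3 h2'
  push_cast at h2
  have hr : (0 : ℝ) ≤ fourthRoot t := by positivity
  have hF : (fivesBefore θ (fourthRoot t) : ℝ) ≤ fivesInBlock θ (fourthRoot t) t := by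
    exact_mod_cast le_max_left _ _
  have hF' : (fivesInBlock θ (fourthRoot t) t : ℝ) ≤ fivesBefore θ (fourthRoot t) ∨
      (fivesInBlock θ (fourthRoot t) t : ℝ) + ((fourthRoot t : ℝ) + 1) ^ 4 ≤
        fivesBefore θ (fourthRoot t + 1) + t := by
    have : fivesInBlock θ (fourthRoot t) t ≤ fivesBefore θ (fourthRoot t) ∨
        fivesInBlock θ (fourthRoot t) t + (fourthRoot t + 1) ^ 4 ≤
          fivesBefore θ (fourthRoot t + 1) + t := by
      unfold fivesInBlock; omega
    exact_mod_cast this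
  generalize (fivesInBlock θ (fourthRoot t) t : ℝ) = F at *
  generalize (fivesBefore θ (fourthRoot t) : ℝ) = G at *
  generalize (fivesBefore θ (fourthRoot t + 1) : ℝ) = G' at *
  generalize (fourthRoot t : ℝ) = r at *
  have e5 := mul_le_mul_of_nonneg_left e3 hθ
  have e6 := mul_le_mul_of_nonneg_left e4 hθ
  have e7 := mul_le_mul_of_nonneg_left e4 (sub_nonneg.2 hθ1)
  have e8 : (r + 1) ^ 4 - r ^ 4 ≤ 4 * (r + 1) ^ 3 := by
    have : 0 ≤ 6 * r ^ 2 + 8 * r + 3 := by positivity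
    linarith
  have e9 : r ^ 3 ≤ (r + 1) ^ 3 := by gcongr; linarith
  have e10 := mul_le_mul_of_nonneg_left e9 hθ
  have e11 : θ * ((r + 1) ^ 4 - r ^ 4 + r ^ 3) ≤ 5 * (r + 1) ^ 3 := by
    have : 0 ≤ r ^ 3 := by positivity
    have : (r + 1) ^ 4 - r ^ 4 + r ^ 3 ≤ 5 * (r + 1) ^ 3 := by linarith
    have h4 : 0 ≤ (r + 1) ^ 4 - r ^ 4 + r ^ 3 := by
      have : r ^ 4 ≤ (r + 1) ^ 4 := by gcongr; linarith
      linarith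
    exact (mul_le_of_le_one_left h4 hθ1).trans this
  have e12 : 1 ≤ (r + 1) ^ 3 := one_le_pow₀ (by linarith)
  refine ⟨?_, by linarith⟩
  rcases hF' with h | h <;> linarith

/-- Pairing with (λ_a, 1), an eigenvector of the matrix of a, multiplies by exactly λ_a. Passing to
the vector of the next quotient costs nothing if the quotient does not decrease, and at most the
factor λ_4/λ_5 at a block boundary. -/
theorem exp_sub_le_contDen_blockQuot (θ : ℝ) (t : ℕ) :
    Real.exp (∑ i ∈ Finset.range t, Real.log (lam (blockQuot θ i)) - fourthRoot t * lamSlope) ≤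
      lam (blockQuot θ t) * contDen (blockQuot θ) (t + 1) + contDen (blockQuot θ) t := by
  induction t with
  | zero => simpa [contDen, fourthRoot] using one_le_lam (blockQuot θ 0)
  | succ t ih =>
    have hsq := lam_sq (blockQuot θ t)
    have hc2 := contDen_nonneg (blockQuot θ) (t + 2)
    have hc1 := contDen_nonneg (blockQuot θ) (t + 1)
    have ih' := mul_le_mul_of_nonneg_right ih (lam_pos (blockQuot θ t)).le
    have e : (lam (blockQuot θ t) * contDen (blockQuot θ) (t + 1) + contDen (blockQuot θ) t) *
        lam (blockQuot θ t) =
        lam (blockQuot θ t) * contDen (blockQuot θ) (t + 2) + contDen (blockQuot θ) (t + 1) := by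
      rw [contDen]; linear_combination contDen (blockQuot θ) (t + 1) * hsq
    rw [e] at ih'
    rw [Finset.sum_range_succ]
    rcases fourthRoot_eq_or t with h | ⟨h, -⟩
    · have hm := lam_mono (blockQuot_le_succ θ h)
      rw [h, add_sub_right_comm, Real.exp_add, exp_log_lam]
      refine ih'.trans ?_
      change _ ≤ lam (blockQuot θ (t + 1)) * contDen (blockQuot θ) (t + 2) + _
      gcongr
    · have hs : lam (blockQuot θ t) * Real.exp (-lamSlope) ≤ lam (blockQuot θ (t + 1)) := by
        have h4 : lam 5 * Real.exp (-lamSlope) = lam 4 := by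
          rw [lamSlope, neg_sub, Real.exp_sub, exp_log_lam, exp_log_lam]
          field_simp [(lam_pos 5).ne']
        have h5 : 4 ≤ blockQuot θ (t + 1) := by unfold blockQuot; omega
        have h6 : blockQuot θ t ≤ 5 := by have := (blockQuot_spec θ t).2; omega
        calc _ ≤ lam 5 * Real.exp (-lamSlope) := by gcongr; exact lam_mono h6
          _ ≤ _ := by rw [h4]; exact lam_mono h5
      have he : Real.exp (-lamSlope) ≤ 1 := Real.exp_le_one_iff.2 (by linarith [lamSlope_nonneg])
      have e2 : ∑ x ∈ Finset.range t, Real.log (lam (blockQuot θ x)) +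
          Real.log (lam (blockQuot θ t)) - (fourthRoot (t + 1) : ℝ) * lamSlope =
          (∑ x ∈ Finset.range t, Real.log (lam (blockQuot θ x)) - fourthRoot t * lamSlope) +
          Real.log (lam (blockQuot θ t)) + -lamSlope := by rw [h]; push_cast; ring
      rw [e2, Real.exp_add, Real.exp_add, exp_log_lam]
      refine (mul_le_mul_of_nonneg_right ih' (Real.exp_pos (-lamSlope)).le).trans ?_
      change _ ≤ lam (blockQuot θ (t + 1)) * contDen (blockQuot θ) (t + 2) + _
      have i1 := mul_le_mul_of_nonneg_right hs hc2
      have i2 := mul_le_mul_of_nonneg_left he hc1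
      linarith

theorem exists_kappa2_hasDerivAtTop : ∃ x : ℝ, x ∈ Set.Ioo (0 : ℝ) 1 ∧ Irrational x ∧
    Tendsto (fun t : ℕ => S x t / (t : ℝ)) atTop (𝓝 kappa2) ∧ HasDerivAtTop questionMark x := by
  set θ := kappa2 - 4 with hθd
  have hθ : 0 < θ := by linarith [four_lt_kappa2]
  have hθ1 : θ ≤ 1 := by linarith [kappa2_lt_five]
  have hκ : kappa2 = 4 + θ := by rw [hθd]; ring
  have hone : ∀ t, 1 ≤ blockQuot θ t := fun t => by unfold blockQuot; omega
  obtain ⟨z, h⟩ := exists_isExpansion hone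
  have hQ : ∀ t, (quotSum (blockQuot θ) t : ℝ) = 4 * t + fivesInBlock θ (fourthRoot t) t := by
    intro t
    exact_mod_cast quotSum_blockQuot hθ.le hθ1 t
  refine ⟨z 0, ⟨h.pos 0, h.lt_one 0⟩, h.irrational, ?_, ?_⟩
  · refine tendsto_div_of_abs_sub_le (C := 6) (by norm_num) fun t => ?_
    have hb := fivesInBlock_bounds hθ.le hθ1 t
    have : 0 ≤ (fourthRoot t : ℝ) ^ 3 * θ := by positivity
    have : 0 ≤ 6 * ((fourthRoot t : ℝ) + 1) ^ 3 := by positivity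
    rw [h.S_eq, hQ, hκ, abs_le]
    constructor <;> linarith [hb.1, hb.2]
  · have hD : 0 < Real.log 2 / 2 - lamSlope := by linarith [lamSlope_lt]
    have hl := log_two_pos
    -- The last term comes from λ_a q_t + q_{t-1} ≤ (λ_5 + 1) q_t. As all quotients are 4 or 5, the
    -- chord bound for log λ is an equality here.
    refine h.hasDerivAtTop_of_exp_le (g := fun t => (t * lamIntercept +
      quotSum (blockQuot θ) t * lamSlope - fourthRoot t * lamSlope) - Real.log (lam 5 + 1))
      (fun t => ?_) ?_
    · have h5 := lam_pos 5
      have e : (t * lamIntercept + quotSum (blockQuot θ) t * lamSlope : ℝ) =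
          ∑ i ∈ Finset.range t, Real.log (lam (blockQuot θ i)) := by
        rw [Finset.sum_congr rfl fun i _ => log_lam_eq (blockQuot_spec θ i).2,
          Finset.sum_add_distrib, ← Finset.sum_mul, quotSum]
        simp
      rw [e, Real.exp_sub, Real.exp_log (by linarith), div_le_iff₀ (by linarith)]
      refine (exp_sub_le_contDen_blockQuot θ t).trans ?_
      have h6 : blockQuot θ t ≤ 5 := by have := (blockQuot_spec θ t).2; omega
      have i1 := mul_le_mul_of_nonneg_right (lam_mono h6) (contDen_nonneg (blockQuot θ) (t + 1))
      have i2 := contDen_le_succ hone t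
      linarith
    -- The cubic gain is the deficit of S_t, the quadratic loss bounds the r descents, and 5 log 2
    -- pays for S_{t+1} in place of S_t.
    · refine tendsto_atTop_mono (fun t => ?_) ((tendsto_cubic_sub_quadratic_atTop
        (mul_pos (mul_pos two_pos hD) hθ) (2 * lamSlope)
        (2 * Real.log (lam 5 + 1) + 5 * Real.log 2)).comp tendsto_fourthRoot)
      have h6 : (blockQuot θ t : ℝ) ≤ 5 := by
        have : blockQuot θ t ≤ 5 := by have := (blockQuot_spec θ t).2; omega
        exact_mod_cast this
      have hb := (fivesInBlock_bounds hθ.le hθ1 t).1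
      have hk := kappa2_mul
      have hr : (fourthRoot t : ℝ) ≤ (fourthRoot t : ℝ) ^ 2 := by
        exact_mod_cast Nat.le_self_pow two_ne_zero _
      have i1 := mul_le_mul_of_nonneg_right hr lamSlope_nonneg
      have i2 := mul_le_mul_of_nonneg_right h6 hl.le
      have i3 := mul_le_mul_of_nonneg_left hb hD.le
      rw [quotSum_succ, Function.comp]
      push_cast
      rw [hQ]
      rw [hκ] at hk
      linear_combination 2 * i1 + i2 + 2 * i3 + 2 * t * hk

end MinkowskiQuestionMark

open MinkowskiQuestionMark in
theorem corollary1 :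
    (∀ x : ℝ, x ∈ Set.Ioo (0 : ℝ) 1 → Irrational x →
      limsup (fun t : ℕ => ((S x t / (t : ℝ) : ℝ) : EReal)) atTop < ((kappa1 : ℝ) : EReal) →
      HasDerivAtTop questionMark x) ∧
    (∃ x : ℝ, x ∈ Set.Ioo (0 : ℝ) 1 ∧ Irrational x ∧
      Tendsto (fun t : ℕ => S x t / (t : ℝ)) atTop (𝓝 kappa1) ∧
      HasDerivAt questionMark 0 x) ∧
    (∀ x : ℝ, x ∈ Set.Ioo (0 : ℝ) 1 → Irrational x →
      ((kappa2 : ℝ) : EReal) < liminf (fun t : ℕ => ((S x t / (t : ℝ) : ℝ) : EReal)) atTop →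
      HasDerivAt questionMark 0 x) ∧
    (∃ x : ℝ, x ∈ Set.Ioo (0 : ℝ) 1 ∧ Irrational x ∧
      Tendsto (fun t : ℕ => S x t / (t : ℝ)) atTop (𝓝 kappa2) ∧
      HasDerivAtTop questionMark x) := by
  exact ⟨fun _ => hasDerivAtTop_of_limsup_lt, exists_kappa1_hasDerivAt_zero,
    fun _ => hasDerivAt_zero_of_lt_liminf, exists_kappa2_hasDerivAtTop⟩
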